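/- Let $\Sigma\subset\mathbb R^n$ be a compact embedded hypersurface (without boundary) of class $C^k$, $k\ge 3$, with a continuous unit normal field $\nu_\Sigma$ (for instance the outer unit normal, if $\Sigma$ encloses a bounded domain). In a local parametrization $\phi$ put $\tau_i=\partial_i\phi$, $g_{ij}=(\tau_i|\tau_j)$, $[g^{ij}]=[g_{ij}]^{-1}$, $g=\det[g_{ij}]$, $\tau^i=g^{ij}\tau_j$, $l_{ij}=(\partial_i\partial_j\phi|\nu_\Sigma)$, and let $[a\otimes b]x=(b|x)a$. The Weingarten tensor is $L_\Sigma=l_{ij}\,\tau^i\otimes\tau^j$, an operator on $\mathbb R^n$; the mean curvature is $g^{ij}l_{ij}$, the sum of the principal curvatures; for a scalar function $h$ on $\Sigma$, $\nabla_\Sigma h=\tau^i\partial_i h$, $\nabla_\Sigma^2h=\tau^i\otimes\partial_i(\tau^j\partial_jh)$ (values in the operators on $\mathbb R^n$), and $\Delta_\Sigma h=\frac1{\sqrt g}\partial_i(\sqrt g\,g^{ij}\partial_jh)$. For a function $\rho\in C^2(\Sigma)$ that is small in $C^2(\Sigma)$ let $\Gamma_\rho$ be the hypersurface parametrized over $\Sigma$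 by $\psi_\rho(p)=p+\rho(p)\nu_\Sigma(p)$, oriented by its unit normal $\nu^\Gamma$ with $(\nu^\Gamma(\psi_\rho(p))\,|\,\nu_\Sigma(p))>0$, and let $L(\rho)(p)$ and $\kappa(\rho)(p)$ be its Weingarten tensor and its mean curvature at the point $\psi_\rho(p)$, $p\in\Sigma$. For a map $M$ let $M'(0)h=\frac{d}{d\varepsilon}M(\varepsilon h)\big|_{\varepsilon=0}$, the limit of the difference quotients being uniform on $\Sigma$. Then for every $h\in C^2(\Sigma)$ these derivatives exist and $$\kappa'(0)h=(\operatorname{tr}L_\Sigma^2)\,h+\Delta_\Sigma h,\qquad L'(0)h=\nu_\Sigma\otimes L_\Sigma\nabla_\Sigma h+h\,L_\Sigma^2+\nabla_\Sigma^2h .$$ -/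

import Mathlib

open scoped Topology

noncomputable section

namespace NormalGraph

/-- Euclidean space `ℝⁿ`. -/
abbrev E (n : ℕ) := EuclideanSpace ℝ (Fin n)

/-! ### Geometry of a parametrized piece of hypersurface

`φ : ℝᵐ → ℝᵐ⁺¹` is a local parametrization, `θ` a parameter, `N` the unit normal at `φ θ`. -/

section Param

variable {m : ℕ} {F : Type*} [NormedAddCommGroup F] [NormedSpace ℝ F]

/-- The partial derivative `∂ᵢ f`. -/
def pd (i : Fin m) (f : E m → F) (θ : E m) : F :=
  fderiv ℝ f θ (EuclideanSpace.single i 1)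

/-- The first fundamental form `g_{ij} = (τᵢ | τⱼ)`, where `τᵢ = ∂ᵢ φ`. -/
def firstForm (φ : E m → E (m + 1)) (θ : E m) : Matrix (Fin m) (Fin m) ℝ :=
  Matrix.of fun i j => inner ℝ (pd i φ θ) (pd j φ θ)

/-- The dual basis `τⁱ = g^{ij} τⱼ` of the tangent space. -/
def dualTangent (φ : E m → E (m + 1)) (i : Fin m) (θ : E m) : E (m + 1) :=
  ∑ j, (firstForm φ θ)⁻¹ i j • pd j φ θ

/-- The second fundamental form `l_{ij} = (∂ᵢ ∂ⱼ φ | N)`. -/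
def secondForm (φ : E m → E (m + 1)) (N : E (m + 1)) (θ : E m) : Matrix (Fin m) (Fin m) ℝ :=
  Matrix.of fun i j => inner ℝ (pd i (pd j φ) θ) N

/-- The tensor product `[a ⊗ b] x = (b | x) a`. -/
def tensor {n : ℕ} (a b : E n) : E n →L[ℝ] E n :=
  InnerProductSpace.rankOne ℝ a b

/-- The Weingarten tensor `l_{ij} τⁱ ⊗ τʲ`, an operator on the ambient space. -/
def weingarten (φ : E m → E (m + 1)) (N : E (m + 1)) (θ : E m) : E (m + 1) →L[ℝ] E (m + 1) :=
  ∑ i, ∑ j, secondForm φ N θ i j • tensor (dualTangent φ i θ) (dualTangent φ j θ)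

/-- The mean curvature `tr (G⁻¹ L)`, the sum of the principal curvatures. -/
def meanCurv (φ : E m → E (m + 1)) (N : E (m + 1)) (θ : E m) : ℝ :=
  ((firstForm φ θ)⁻¹ * secondForm φ N θ).trace

/-- The surface gradient `τⁱ ∂ᵢ u` of a scalar field, given in the parameters. -/
def grad (φ : E m → E (m + 1)) (u : E m → ℝ) (θ : E m) : E (m + 1) :=
  ∑ i, pd i u θ • dualTangent φ i θ

/-- The surface gradient `τⁱ ⊗ ∂ᵢ f` of a vector field, given in the parameters. -/
def gradVec (φ : E m → E (m + 1)) (f : E m → E (m + 1)) (θ : E m) : E (m + 1) →L[ℝ] E (m + 1) :=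
  ∑ i, tensor (dualTangent φ i θ) (pd i f θ)

/-- The second surface gradient `∇² u = ∇ (∇ u)`. It has values in the operators on the
ambient space and includes the normal component of `∂ᵢ (∇ u)`. -/
def grad2 (φ : E m → E (m + 1)) (u : E m → ℝ) (θ : E m) : E (m + 1) →L[ℝ] E (m + 1) :=
  gradVec φ (grad φ u) θ

/-- The surface divergence `(1/√g) ∂ᵢ (√g fⁱ)`, `fⁱ = (f | τⁱ)`, of a tangential field. -/
def surfDiv (φ : E m → E (m + 1)) (f : E m → E (m + 1)) (θ : E m) : ℝ :=
  (√(firstForm φ θ).det)⁻¹ *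
    ∑ i, pd i (fun η => √(firstForm φ η).det * inner ℝ (f η) (dualTangent φ i η)) θ

/-- The Laplace–Beltrami operator `div ∇ u`. -/
def laplaceBeltrami (φ : E m → E (m + 1)) (u : E m → ℝ) (θ : E m) : ℝ :=
  surfDiv φ (grad φ u) θ

/-- The unit normal of the parametrized hypersurface at `φ θ` on the side of `w`: the normalized
orthogonal projection of `w` onto the orthogonal complement of the tangent space. -/
def unitNormal (φ : E m → E (m + 1)) (w : E (m + 1)) (θ : E m) : E (m + 1) :=
  let q := (Submodule.span ℝ (Set.range fun i => pd i φ θ))ᗮ.starProjection w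
  ‖q‖⁻¹ • q

end Param

/-! ### Closed embedded hypersurfaces -/

/-- The inclusion `θ ↦ (θ, 0)` of `ℝᵐ` in `ℝᵐ⁺¹`. -/
def incl {m : ℕ} (θ : E m) : E (m + 1) :=
  WithLp.toLp 2 (Fin.snoc (α := fun _ => ℝ) θ.ofLp 0)

/-- A closed (compact, without boundary) embedded hypersurface of class `C^k` in `ℝᵐ⁺¹`, with an
arbitrary choice, at each of its points `p`, of a `C^k` diffeomorphism `chart p` of a ball about `p`
onto an open set that takes `p` to `0` and the hypersurface to `ℝᵐ × {0}`. -/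
structure ClosedHypersurface (m : ℕ) (k : WithTop ℕ∞) where
  carrier : Set (E (m + 1))
  isCompact : IsCompact carrier
  chart : E (m + 1) → OpenPartialHomeomorph (E (m + 1)) (E (m + 1))
  source_eq : ∀ p ∈ carrier, ∃ r > 0, (chart p).source = Metric.ball p r
  contDiffOn : ∀ p ∈ carrier, ContDiffOn ℝ k (chart p) (chart p).source
  contDiffOn_symm : ∀ p ∈ carrier, ContDiffOn ℝ k (chart p).symm (chart p).target
  map_center : ∀ p ∈ carrier, chart p p = 0
  flat : ∀ p ∈ carrier, ∀ x ∈ (chart p).source, x ∈ carrier ↔ chart p x (Fin.last m) = 0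

namespace ClosedHypersurface

variable {m : ℕ} {k : WithTop ℕ∞} (S : ClosedHypersurface m k)

/-- The local parametrization `φ(θ) = Φ⁻¹(θ, 0)` at `p`; `φ(0) = p`. -/
def param (p : E (m + 1)) (θ : E m) : E (m + 1) :=
  (S.chart p).symm (incl θ)

/-- The open parameter set of `param p`. -/
def paramDomain (p : E (m + 1)) : Set (E m) :=
  incl ⁻¹' (S.chart p).target

/-- `h` restricts to a function of class `C^r` on the hypersurface. Only the values of `h` on the
hypersurface matter. -/
def IsOfClass (r : WithTop ℕ∞) (h : E (m + 1) → ℝ) : Prop :=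
  ∀ p ∈ S.carrier, ContDiffOn ℝ r (h ∘ S.param p) (S.paramDomain p)

/-- `ν` is a continuous unit normal field on the hypersurface. -/
structure IsUnitNormalField (ν : E (m + 1) → E (m + 1)) : Prop where
  continuousOn : ContinuousOn ν S.carrier
  norm_eq_one : ∀ p ∈ S.carrier, ‖ν p‖ = 1
  normal : ∀ p ∈ S.carrier, ∀ i, inner ℝ (pd i (S.param p) 0) (ν p) = 0

/-- The Weingarten tensor `L_Σ(p)`. -/
def weingartenAt (ν : E (m + 1) → E (m + 1)) (p : E (m + 1)) : E (m + 1) →L[ℝ] E (m + 1) :=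
  weingarten (S.param p) (ν p) 0

/-- The surface gradient `∇_Σ h(p)`. -/
def gradAt (h : E (m + 1) → ℝ) (p : E (m + 1)) : E (m + 1) :=
  grad (S.param p) (h ∘ S.param p) 0

/-- The second surface gradient `∇_Σ² h(p)`. -/
def grad2At (h : E (m + 1) → ℝ) (p : E (m + 1)) : E (m + 1) →L[ℝ] E (m + 1) :=
  grad2 (S.param p) (h ∘ S.param p) 0

/-- The Laplace–Beltrami operator `Δ_Σ h(p)`. -/
def laplaceAt (h : E (m + 1) → ℝ) (p : E (m + 1)) : ℝ :=
  laplaceBeltrami (S.param p) (h ∘ S.param p) 0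

/-- The map `ψ_ρ(p) = p + ρ(p) ν(p)` whose image is the normal graph `Γ_ρ`. -/
def graphMap (ν : E (m + 1) → E (m + 1)) (ρ : E (m + 1) → ℝ) (p : E (m + 1)) : E (m + 1) :=
  p + ρ p • ν p

/-- The local parametrization `ψ_ρ ∘ φ` of the normal graph `Γ_ρ` about `ψ_ρ(p)`. -/
def graphParam (ν : E (m + 1) → E (m + 1)) (ρ : E (m + 1) → ℝ) (p : E (m + 1)) (θ : E m) :
    E (m + 1) :=
  graphMap ν ρ (S.param p θ)

/-- The unit normal of `Γ_ρ` at `ψ_ρ(p)` that lies on the side of `ν(p)`. -/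
def graphNormal (ν : E (m + 1) → E (m + 1)) (ρ : E (m + 1) → ℝ) (p : E (m + 1)) : E (m + 1) :=
  unitNormal (S.graphParam ν ρ p) (ν p) 0

/-- `L(ρ)(p)`: the Weingarten tensor of `Γ_ρ` at the point `ψ_ρ(p)`. -/
def graphWeingarten (ν : E (m + 1) → E (m + 1)) (ρ : E (m + 1) → ℝ) (p : E (m + 1)) :
    E (m + 1) →L[ℝ] E (m + 1) :=
  weingarten (S.graphParam ν ρ p) (S.graphNormal ν ρ p) 0

/-- `κ(ρ)(p)`: the mean curvature of `Γ_ρ` at the point `ψ_ρ(p)`. -/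
def graphMeanCurv (ν : E (m + 1) → E (m + 1)) (ρ : E (m + 1) → ℝ) (p : E (m + 1)) : ℝ :=
  meanCurv (S.graphParam ν ρ p) (S.graphNormal ν ρ p) 0

/-- `M'(ρ) h = D`, that is `d/dε M(ρ + ε h) = D` at `ε = 0`, the difference quotients converging
uniformly on the hypersurface. -/
def HasVariation {F : Type*} [NormedAddCommGroup F] [NormedSpace ℝ F]
    (M : (E (m + 1) → ℝ) → E (m + 1) → F) (ρ h : E (m + 1) → ℝ) (D : E (m + 1) → F) : Prop :=
  TendstoUniformlyOn (fun (ε : ℝ) p => ε⁻¹ • (M (ρ + ε • h) p - M ρ p)) D (𝓝[≠] 0) S.carrier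

end ClosedHypersurface

end NormalGraph

end

/-! At a point of a hypersurface the Weingarten tensor is a function of finitely many vectors: the
first and second derivatives of a parametrization, and a vector `w` that selects the side of the
normal. This function, `frameShape`, is `C¹` wherever the Gram determinant is nonzero and `w` is not
tangential. In a fixed chart the graph of `ε h` has data `d + ε e`, where `e` collects the
derivatives of `h ν`. The variation is therefore the derivative of `frameShape` at `d` along `e`.

That derivative is found without differentiating `g^{ij}`. The tensor `W` and the normal `N` of a
frame satisfy `(W τⱼ | τᵢ) = (sᵢⱼ | N)`, `W N = 0` and `(W x | N) = 0`. Differentiating these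
identities (`frameShape_variation`) yields every block of `W'` relative to the tangent space and the
normal line. With `N' = -∇u` and the Weingarten equations (`pd_normal`) the blocks agree with those
of the asserted operator (`fderiv_frameShape_normal_variation`, `operator_ext_frame`). The formula
is asymmetric in appearance only: `∇²u` maps `ν` to `L ∇u`, so it already contains the transpose of
`ν ⊗ L ∇u`.

Uniformity comes from strict differentiability of `frameShape`: the data depend continuously on the
point, so the difference quotients converge jointly in `ε` and the point, and compactness does the
rest. Each point carries its own unrelated chart; `unitNormal_comp` and `weingarten_comp` allow all
points near `p` to be treated in the chart at `p`. The field `ν` is only assumed continuous, and `k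
≥ 3` makes it `C²` in the parameters.

The mean curvature is the trace of the Weingarten tensor, so its variation is the trace of the other
formula: `ν ⊗ L ∇h` is traceless because `L ∇h` is tangential, and `tr ∇² = Δ`
(`laplaceBeltrami_eq_trace_grad2`). -/

namespace NormalGraph

open Matrix

/-! ### Frames of a hyperplane -/

section Frame

variable {m n : ℕ}

/-- The dual frame `τⁱ = g^{ij} τⱼ` of the span of `τ`. -/
noncomputable def frameDual (τ : Fin m → E n) (i : Fin m) : E n :=
  ∑ j, (gram ℝ τ)⁻¹ i j • τ j

/-- The component of `w` orthogonal to the span of `τ`. -/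
noncomputable def frameNormalPart (τ : Fin m → E n) (w : E n) : E n :=
  w - ∑ i, inner ℝ (τ i) w • frameDual τ i

/-- The unit vector orthogonal to the span of `τ` on the side of `w`. -/
noncomputable def frameNormal (τ : Fin m → E n) (w : E n) : E n :=
  ‖frameNormalPart τ w‖⁻¹ • frameNormalPart τ w

/-- The operator `(sᵢⱼ | N) τⁱ ⊗ τʲ`. -/
noncomputable def frameWeingarten (τ : Fin m → E n) (s : Fin m → Fin m → E n) (N : E n) :
    E n →L[ℝ] E n :=
  ∑ i, ∑ j, inner ℝ (s i j) N • tensor (frameDual τ i) (frameDual τ j)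

lemma tensor_apply (a b x : E n) : tensor a b x = inner ℝ b x • a := rfl

lemma trace_tensor (a b : E n) :
    LinearMap.trace ℝ (E n) (tensor a b : E n →L[ℝ] E n) = inner ℝ b a := by
  have : ((tensor a b : E n →L[ℝ] E n) : E n →ₗ[ℝ] E n)
      = dualTensorHom ℝ (E n) (E n) ((innerₗ (E n) b) ⊗ₜ[ℝ] a) := by
    ext x
    simp [tensor]
  rw [this, LinearMap.trace_eq_contract_apply, contractLeft_apply]
  rfl

lemma gram_inv_symm (τ : Fin m → E n) (i j : Fin m) :
    (gram ℝ τ)⁻¹ i j = (gram ℝ τ)⁻¹ j i := by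
  have h := (isHermitian_gram ℝ τ).inv
  simpa using (h.apply i j).symm

/-- No independence is needed: `G⁻¹ G G⁻¹ = G⁻¹` also holds for singular `G`, whose inverse is `0`
by convention. -/
lemma inner_frameDual_frameDual (τ : Fin m → E n) (i j : Fin m) :
    inner ℝ (frameDual τ i) (frameDual τ j) = (gram ℝ τ)⁻¹ i j := by
  have h : (gram ℝ τ)⁻¹ * gram ℝ τ * (gram ℝ τ)⁻¹ = (gram ℝ τ)⁻¹ := by
    by_cases hd : IsUnit (gram ℝ τ).det
    · rw [nonsing_inv_mul _ hd, one_mul]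
    · simp [nonsing_inv_apply_not_isUnit _ hd]
  have h' := congrFun (congrFun h i) j
  rw [mul_apply] at h'
  rw [← h', frameDual, frameDual, inner_sum]
  refine Finset.sum_congr rfl fun k _ => ?_
  rw [inner_smul_right, sum_inner, mul_apply, mul_comm, gram_inv_symm τ j k]
  congr 1
  refine Finset.sum_congr rfl fun l _ => ?_
  simp [inner_smul_left, gram_apply]

lemma inner_frameDual {τ : Fin m → E n} (hτ : (gram ℝ τ).det ≠ 0) (i j : Fin m) :
    inner ℝ (frameDual τ i) (τ j) = if i = j then 1 else 0 := by
  have h := congrFun (congrFun (nonsing_inv_mul (gram ℝ τ) hτ.isUnit) i) j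
  rw [mul_apply, one_apply] at h
  rw [← h, frameDual, sum_inner]
  simp [inner_smul_left, gram_apply]

lemma inner_frameDual_eq_zero {τ : Fin m → E n} {N : E n} (hN : ∀ i, inner ℝ (τ i) N = 0)
    (i : Fin m) : inner ℝ (frameDual τ i) N = 0 := by
  simp [frameDual, sum_inner, inner_smul_left, hN]

lemma inner_frameNormalPart {τ : Fin m → E n} (hτ : (gram ℝ τ).det ≠ 0) (w : E n) (i : Fin m) :
    inner ℝ (τ i) (frameNormalPart τ w) = 0 := by
  have : ∀ j, inner ℝ (τ i) (frameDual τ j) = if j = i then (1 : ℝ) else 0 := fun j => by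
    rw [real_inner_comm, inner_frameDual hτ]
  simp [frameNormalPart, inner_sub_right, inner_sum, inner_smul_right, this]

lemma inner_frameNormal {τ : Fin m → E n} (hτ : (gram ℝ τ).det ≠ 0) (w : E n) (i : Fin m) :
    inner ℝ (τ i) (frameNormal τ w) = 0 := by
  rw [frameNormal, inner_smul_right, inner_frameNormalPart hτ, mul_zero]

lemma frameDual_mem_span (τ : Fin m → E n) (i : Fin m) :
    frameDual τ i ∈ Submodule.span ℝ (Set.range τ) :=
  Submodule.sum_mem _ fun j _ => Submodule.smul_mem _ _ (Submodule.subset_span ⟨j, rfl⟩)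

lemma mem_span_orthogonal_iff {τ : Fin m → E n} {x : E n} :
    x ∈ (Submodule.span ℝ (Set.range τ))ᗮ ↔ ∀ i, inner ℝ (τ i) x = 0 := by
  rw [Submodule.mem_orthogonal]
  refine ⟨fun h i => h _ (Submodule.subset_span ⟨i, rfl⟩), fun h u hu => ?_⟩
  induction hu using Submodule.span_induction with
  | mem x hx => obtain ⟨i, rfl⟩ := hx; exact h i
  | zero => simp
  | add x y _ _ hx hy => rw [inner_add_left, hx, hy, add_zero]
  | smul a x _ hx => rw [inner_smul_left, hx, mul_zero]

/-- Links the coordinate-free normal of `unitNormal` with an explicit expression that is visibly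
smooth in the frame. -/
lemma starProjection_span_orthogonal {τ : Fin m → E n} (hτ : (gram ℝ τ).det ≠ 0) (w : E n) :
    (Submodule.span ℝ (Set.range τ))ᗮ.starProjection w = frameNormalPart τ w := by
  refine Submodule.eq_starProjection_of_mem_of_inner_eq_zero
    (mem_span_orthogonal_iff.2 (inner_frameNormalPart hτ w)) fun x hx => ?_
  have : w - frameNormalPart τ w = ∑ i, inner ℝ (τ i) w • frameDual τ i := by
    simp [frameNormalPart]
  rw [this]
  refine Submodule.inner_right_of_mem_orthogonal (K := Submodule.span ℝ (Set.range τ)) ?_ hx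
  exact Submodule.sum_mem _ fun i _ => Submodule.smul_mem _ _ (frameDual_mem_span τ i)

lemma frameWeingarten_apply (τ : Fin m → E n) (s : Fin m → Fin m → E n) (N x : E n) :
    frameWeingarten τ s N x
      = ∑ i, ∑ j, inner ℝ (s i j) N • inner ℝ (frameDual τ j) x • frameDual τ i := by
  simp [frameWeingarten, tensor]

lemma inner_frameWeingarten {τ : Fin m → E n} (hτ : (gram ℝ τ).det ≠ 0)
    (s : Fin m → Fin m → E n) (N : E n) (i j : Fin m) :
    inner ℝ (frameWeingarten τ s N (τ j)) (τ i) = inner ℝ (s i j) N := by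
  simp [frameWeingarten_apply, inner_frameDual hτ, sum_inner, inner_smul_left]

lemma frameWeingarten_apply_eq_zero {τ : Fin m → E n} {N x : E n} (s : Fin m → Fin m → E n)
    (hx : ∀ i, inner ℝ (τ i) x = 0) : frameWeingarten τ s N x = 0 := by
  simp [frameWeingarten_apply, inner_frameDual_eq_zero hx]

lemma inner_frameWeingarten_eq_zero {τ : Fin m → E n} {N x : E n} (s : Fin m → Fin m → E n)
    (hx : ∀ i, inner ℝ (τ i) x = 0) (y : E n) : inner ℝ (frameWeingarten τ s N y) x = 0 := by
  simp [frameWeingarten_apply, sum_inner, inner_smul_left, inner_frameDual_eq_zero hx]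

lemma inner_frameWeingarten_comm {τ : Fin m → E n} {s : Fin m → Fin m → E n}
    (hs : ∀ i j, s i j = s j i) (N x y : E n) :
    inner ℝ (frameWeingarten τ s N x) y = inner ℝ x (frameWeingarten τ s N y) := by
  simp only [frameWeingarten_apply, sum_inner, inner_sum, inner_smul_left, inner_smul_right]
  rw [Finset.sum_comm]
  refine Finset.sum_congr rfl fun i _ => Finset.sum_congr rfl fun j _ => ?_
  rw [hs j i, real_inner_comm (frameDual τ i) x]
  simp only [conj_trivial]
  ring

end Frame

/-! ### Vectors and operators determined by a frame and a normal vector -/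

section Hyperplane

variable {m : ℕ} {τ : Fin m → E (m + 1)} {ν : E (m + 1)}

lemma span_orthogonal_eq (hτ : (gram ℝ τ).det ≠ 0) (hν : ν ≠ 0)
    (hn : ∀ i, inner ℝ (τ i) ν = 0) :
    (Submodule.span ℝ (Set.range τ))ᗮ = Submodule.span ℝ {ν} := by
  have hli := (det_gram_ne_zero_iff_linearIndependent (𝕜 := ℝ)).1 hτ
  have h1 : Module.finrank ℝ (Submodule.span ℝ (Set.range τ)) = m := by
    simpa using finrank_span_eq_card hli
  have h2 := Submodule.finrank_add_finrank_orthogonal (Submodule.span ℝ (Set.range τ))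
  have h3 : Module.finrank ℝ (E (m + 1)) = m + 1 := by simp
  symm
  refine Submodule.eq_of_le_of_finrank_eq ?_ ?_
  · rw [Submodule.span_singleton_le_iff_mem]
    exact mem_span_orthogonal_iff.2 hn
  · rw [finrank_span_singleton hν]; omega

lemma frame_induction (hτ : (gram ℝ τ).det ≠ 0) (hν : ν ≠ 0)
    (hn : ∀ i, inner ℝ (τ i) ν = 0) (x : E (m + 1)) :
    x ∈ Submodule.span ℝ (insert ν (Set.range τ)) := by
  rw [Submodule.span_insert, ← span_orthogonal_eq hτ hν hn, sup_comm,
    Submodule.sup_orthogonal_of_hasOrthogonalProjection]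
  trivial

lemma eq_of_inner_frame_eq (hτ : (gram ℝ τ).det ≠ 0) (hν : ν ≠ 0)
    (hn : ∀ i, inner ℝ (τ i) ν = 0) {x y : E (m + 1)}
    (h : ∀ i, inner ℝ x (τ i) = inner ℝ y (τ i)) (h' : inner ℝ x ν = inner ℝ y ν) : x = y := by
  refine ext_inner_right ℝ fun z => ?_
  have hz := frame_induction hτ hν hn z
  induction hz using Submodule.span_induction with
  | mem z hz =>
    rcases hz with rfl | ⟨i, rfl⟩
    exacts [h', h i]
  | zero => simp
  | add a b _ _ ha hb => rw [inner_add_right, inner_add_right, ha, hb]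
  | smul a b _ hb => rw [inner_smul_right, inner_smul_right, hb]

/-- Operators that agree on the blocks of the decomposition given by a frame and a normal vector
are equal. -/
lemma operator_ext_frame (hτ : (gram ℝ τ).det ≠ 0) (hν : ν ≠ 0)
    (hn : ∀ i, inner ℝ (τ i) ν = 0) {A B : E (m + 1) →L[ℝ] E (m + 1)}
    (h : ∀ i j, inner ℝ (A (τ j)) (τ i) = inner ℝ (B (τ j)) (τ i)) (h₁ : A ν = B ν)
    (h₂ : ∀ x, inner ℝ (A x) ν = inner ℝ (B x) ν) : A = B := by
  have key : ∀ j, A (τ j) = B (τ j) := fun j =>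
    eq_of_inner_frame_eq hτ hν hn (fun i => h i j) (h₂ _)
  ext1 x
  have hx := frame_induction hτ hν hn x
  induction hx using Submodule.span_induction with
  | mem z hz =>
    rcases hz with rfl | ⟨i, rfl⟩
    exacts [h₁, key i]
  | zero => simp
  | add a b _ _ ha hb => rw [map_add, map_add, ha, hb]
  | smul a b _ hb => rw [map_smul, map_smul, hb]

/-- In codimension one the orthogonal complement of the frame is the line through `ν`. -/
lemma frameNormalPart_of_unit (hτ : (gram ℝ τ).det ≠ 0) (hν : ‖ν‖ = 1)
    (hn : ∀ i, inner ℝ (τ i) ν = 0) (w : E (m + 1)) :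
    frameNormalPart τ w = inner ℝ ν w • ν := by
  have hn' : ∀ i, inner ℝ ν (τ i) = 0 := fun i => by rw [real_inner_comm, hn]
  refine eq_of_inner_frame_eq hτ (by rintro rfl; simp at hν) hn (fun i => ?_) ?_
  · rw [real_inner_comm, inner_frameNormalPart hτ, inner_smul_left, hn', mul_zero]
  · simp [frameNormalPart, inner_sub_left, sum_inner, inner_smul_left,
      inner_frameDual_eq_zero hn, hν, real_inner_comm]

lemma frameNormal_of_unit (hτ : (gram ℝ τ).det ≠ 0) (hν : ‖ν‖ = 1)
    (hn : ∀ i, inner ℝ (τ i) ν = 0) {w : E (m + 1)} (hw : 0 < inner ℝ ν w) :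
    frameNormal τ w = ν := by
  rw [frameNormal, frameNormalPart_of_unit hτ hν hn, norm_smul, hν, mul_one, smul_smul,
    Real.norm_of_nonneg hw.le, inv_mul_cancel₀ hw.ne', one_smul]

end Hyperplane

/-! ### Smooth dependence on the frame -/

section Smooth

variable {m n : ℕ} {X : Type*} [NormedAddCommGroup X] [NormedSpace ℝ X] {r : WithTop ℕ∞} {x₀ : X}

lemma contDiffAt_det {G : X → Matrix (Fin m) (Fin m) ℝ}
    (hG : ∀ i j, ContDiffAt ℝ r (fun x => G x i j) x₀) :
    ContDiffAt ℝ r (fun x => (G x).det) x₀ := by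
  simp only [det_apply']
  exact ContDiffAt.sum fun σ _ => contDiffAt_const.mul (contDiffAt_prod fun i _ => hG _ _)

/-- By Cramer's formula each entry of the inverse is a quotient of polynomials in the entries. -/
lemma contDiffAt_inv_apply {G : X → Matrix (Fin m) (Fin m) ℝ}
    (hG : ∀ i j, ContDiffAt ℝ r (fun x => G x i j) x₀) (h₀ : (G x₀).det ≠ 0) (i j : Fin m) :
    ContDiffAt ℝ r (fun x => (G x)⁻¹ i j) x₀ := by
  have hadj : ContDiffAt ℝ r (fun x => (G x).adjugate i j) x₀ := by
    simp only [adjugate_apply]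
    refine contDiffAt_det fun a b => ?_
    by_cases hab : a = j
    · subst hab
      simpa using contDiffAt_const
    · simpa [updateRow_ne hab] using hG a b
  simp only [inv_def, Matrix.smul_apply, Ring.inverse_eq_inv', smul_eq_mul]
  exact ((contDiffAt_det hG).inv h₀).mul hadj

/-- Jacobi's formula. The Leibniz expansion is differentiated one column at a time, and the
resulting determinants with one replaced column are evaluated through the adjugate. -/
lemma fderiv_det {G : X → Matrix (Fin m) (Fin m) ℝ}
    (hG : ∀ i j, DifferentiableAt ℝ (fun x => G x i j) x₀) (h₀ : (G x₀).det ≠ 0) (v : X) :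
    fderiv ℝ (fun x => (G x).det) x₀ v
      = (G x₀).det * ∑ i, ∑ j, (G x₀)⁻¹ i j * fderiv ℝ (fun x => G x j i) x₀ v := by
  set G' : Matrix (Fin m) (Fin m) ℝ := of fun i j => fderiv ℝ (fun x => G x i j) x₀ v with hG'
  have h1 : HasFDerivAt (fun x => (G x).det) (∑ σ : Equiv.Perm (Fin m),
      ((Equiv.Perm.sign σ : ℤ) : ℝ) • ∑ i, (∏ j ∈ Finset.univ.erase i, G x₀ (σ j) j) •
        fderiv ℝ (fun x => G x (σ i) i) x₀) x₀ := by
    simp only [det_apply']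
    exact HasFDerivAt.fun_sum fun σ _ =>
      (HasFDerivAt.finsetProd fun i _ => (hG (σ i) i).hasFDerivAt).const_mul _
  have h2 : ∑ i, ((G x₀).updateCol i (fun a => G' a i)).det
      = ∑ i, ∑ j, (G x₀).adjugate i j * G' j i := by
    refine Finset.sum_congr rfl fun i _ => ?_
    rw [← cramer_apply, cramer_eq_adjugate_mulVec]
    rfl
  have h3 : ∑ i, ∑ j, (G x₀).adjugate i j * G' j i
      = (G x₀).det * ∑ i, ∑ j, (G x₀)⁻¹ i j * G' j i := by
    simp only [inv_def, Matrix.smul_apply, Ring.inverse_eq_inv', smul_eq_mul, Finset.mul_sum]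
    refine Finset.sum_congr rfl fun i _ => Finset.sum_congr rfl fun j _ => ?_
    field_simp
  change _ = (G x₀).det * ∑ i, ∑ j, (G x₀)⁻¹ i j * G' j i
  rw [← h3, ← h2, h1.fderiv]
  simp only [det_apply', _root_.sum_apply, _root_.smul_apply, smul_eq_mul]
  rw [Finset.sum_comm]
  refine Finset.sum_congr rfl fun σ _ => ?_
  rw [Finset.mul_sum]
  refine Finset.sum_congr rfl fun i _ => ?_
  rw [← Finset.mul_prod_erase _ _ (Finset.mem_univ i), updateCol_self, mul_comm (G' _ _)]
  congr 2
  refine Finset.prod_congr rfl fun j hj => ?_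
  rw [updateCol_ne (Finset.ne_of_mem_erase hj)]

lemma contDiffAt_gram {τ : X → Fin m → E n} (hτ : ∀ i, ContDiffAt ℝ r (fun x => τ x i) x₀)
    (i j : Fin m) : ContDiffAt ℝ r (fun x => gram ℝ (τ x) i j) x₀ := by
  simp only [gram_apply]
  exact (hτ i).inner ℝ (hτ j)

lemma contDiffAt_frameDual {τ : X → Fin m → E n}
    (hτ : ∀ i, ContDiffAt ℝ r (fun x => τ x i) x₀) (h₀ : (gram ℝ (τ x₀)).det ≠ 0) (i : Fin m) :
    ContDiffAt ℝ r (fun x => frameDual (τ x) i) x₀ := by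
  simp only [frameDual]
  exact ContDiffAt.sum fun j _ => (contDiffAt_inv_apply (contDiffAt_gram hτ) h₀ i j).smul (hτ j)

lemma contDiffAt_frameNormalPart {τ : X → Fin m → E n} {w : X → E n}
    (hτ : ∀ i, ContDiffAt ℝ r (fun x => τ x i) x₀) (hw : ContDiffAt ℝ r w x₀)
    (h₀ : (gram ℝ (τ x₀)).det ≠ 0) :
    ContDiffAt ℝ r (fun x => frameNormalPart (τ x) (w x)) x₀ := by
  simp only [frameNormalPart]
  exact hw.sub (ContDiffAt.sum fun i _ =>
    ((hτ i).inner ℝ hw).smul (contDiffAt_frameDual hτ h₀ i))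

lemma contDiffAt_frameNormal {τ : X → Fin m → E n} {w : X → E n}
    (hτ : ∀ i, ContDiffAt ℝ r (fun x => τ x i) x₀) (hw : ContDiffAt ℝ r w x₀)
    (h₀ : (gram ℝ (τ x₀)).det ≠ 0) (h₁ : frameNormalPart (τ x₀) (w x₀) ≠ 0) :
    ContDiffAt ℝ r (fun x => frameNormal (τ x) (w x)) x₀ := by
  have h := contDiffAt_frameNormalPart hτ hw h₀
  simp only [frameNormal]
  exact ((h.norm ℝ h₁).inv (norm_ne_zero_iff.2 h₁)).smul h

lemma contDiffAt_tensor {a b : X → E n} (ha : ContDiffAt ℝ r a x₀) (hb : ContDiffAt ℝ r b x₀) :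
    ContDiffAt ℝ r (fun x => tensor (a x) (b x)) x₀ := by
  have : ContDiffAt ℝ r (fun x => (innerSL ℝ (b x)).smulRight (a x)) x₀ :=
    ((innerSL ℝ (E := E n)).contDiff.contDiffAt.comp x₀ hb).smulRight ha
  exact this

lemma contDiffAt_frameWeingarten {τ : X → Fin m → E n} {s : X → Fin m → Fin m → E n}
    {N : X → E n} (hτ : ∀ i, ContDiffAt ℝ r (fun x => τ x i) x₀)
    (hs : ∀ i j, ContDiffAt ℝ r (fun x => s x i j) x₀) (hN : ContDiffAt ℝ r N x₀)
    (h₀ : (gram ℝ (τ x₀)).det ≠ 0) :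
    ContDiffAt ℝ r (fun x => frameWeingarten (τ x) (s x) (N x)) x₀ := by
  simp only [frameWeingarten]
  exact ContDiffAt.sum fun i _ => ContDiffAt.sum fun j _ => ((hs i j).inner ℝ hN).smul
    (contDiffAt_tensor (contDiffAt_frameDual hτ h₀ i) (contDiffAt_frameDual hτ h₀ j))

end Smooth

/-! ### Calculus in a parametrization -/

section PartialDerivatives

variable {m : ℕ} {F : Type*} [NormedAddCommGroup F] [NormedSpace ℝ F]

lemma fderiv_apply_eq_sum_pd (f : E m → F) (θ a : E m) :
    fderiv ℝ f θ a = ∑ i, a i • pd i f θ := by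
  have h : a = ∑ i, a i • EuclideanSpace.single i (1 : ℝ) := by
    ext j
    simp [Pi.single_apply]
  conv_lhs => rw [h]
  simp [pd]

lemma span_range_pd (f : E m → F) (θ : E m) :
    Submodule.span ℝ (Set.range fun i => pd i f θ) = (fderiv ℝ f θ : E m →ₗ[ℝ] F).range := by
  refine le_antisymm (Submodule.span_le.2 ?_) ?_
  · rintro _ ⟨i, rfl⟩
    exact ⟨EuclideanSpace.single i 1, rfl⟩
  · rintro _ ⟨a, rfl⟩
    change fderiv ℝ f θ a ∈ _
    rw [fderiv_apply_eq_sum_pd]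
    exact Submodule.sum_mem _ fun i _ => Submodule.smul_mem _ _ (Submodule.subset_span ⟨i, rfl⟩)

lemma pd_congr {f g : E m → F} {θ : E m} (h : f =ᶠ[𝓝 θ] g) (i : Fin m) : pd i f θ = pd i g θ := by
  rw [pd, pd, h.fderiv_eq]

lemma pd_eventuallyEq {f g : E m → F} {θ : E m} (h : f =ᶠ[𝓝 θ] g) (i : Fin m) :
    pd i f =ᶠ[𝓝 θ] pd i g := by
  filter_upwards [h.eventuallyEq_nhds] with η hη
  exact pd_congr hη i

lemma pd_add {f g : E m → F} {θ : E m} (hf : DifferentiableAt ℝ f θ)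
    (hg : DifferentiableAt ℝ g θ) (i : Fin m) :
    pd i (fun η => f η + g η) θ = pd i f θ + pd i g θ := by
  rw [pd, fderiv_fun_add hf hg]; rfl

lemma pd_const_smul {f : E m → F} {θ : E m} (c : ℝ) (hf : DifferentiableAt ℝ f θ) (i : Fin m) :
    pd i (fun η => c • f η) θ = c • pd i f θ := by
  rw [pd, fderiv_fun_const_smul hf]; rfl

lemma pd_smul {u : E m → ℝ} {f : E m → F} {θ : E m} (hu : DifferentiableAt ℝ u θ)
    (hf : DifferentiableAt ℝ f θ) (i : Fin m) :
    pd i (fun η => u η • f η) θ = u θ • pd i f θ + pd i u θ • f θ := by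
  rw [pd, fderiv_fun_smul hu hf]; rfl

lemma pd_mul {u f : E m → ℝ} {θ : E m} (hu : DifferentiableAt ℝ u θ)
    (hf : DifferentiableAt ℝ f θ) (i : Fin m) :
    pd i (fun η => u η * f η) θ = u θ * pd i f θ + pd i u θ * f θ :=
  pd_smul hu hf i

lemma pd_inner {n : ℕ} {f g : E m → E n} {θ : E m} (hf : DifferentiableAt ℝ f θ)
    (hg : DifferentiableAt ℝ g θ) (i : Fin m) :
    pd i (fun η => inner ℝ (f η) (g η)) θ
      = inner ℝ (f θ) (pd i g θ) + inner ℝ (pd i f θ) (g θ) := by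
  rw [pd, fderiv_inner_apply ℝ hf hg]; rfl

lemma contDiffAt_pd {r s : WithTop ℕ∞} {f : E m → F} {θ : E m} (hf : ContDiffAt ℝ s f θ)
    (hrs : r + 1 ≤ s) (i : Fin m) : ContDiffAt ℝ r (pd i f) θ :=
  (hf.fderiv_right hrs).clm_apply contDiffAt_const

lemma pd_pd_eq {f : E m → F} {θ : E m} (hf : ContDiffAt ℝ 2 f θ) (i j : Fin m) :
    pd i (pd j f) θ
      = fderiv ℝ (fderiv ℝ f) θ (EuclideanSpace.single i 1) (EuclideanSpace.single j 1) := by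
  have h1 : DifferentiableAt ℝ (fderiv ℝ f) θ :=
    (hf.fderiv_right (m := 1) (by norm_num)).differentiableAt (by norm_num)
  change fderiv ℝ (fun η => fderiv ℝ f η (EuclideanSpace.single j 1)) θ _ = _
  rw [fderiv_clm_apply h1 (differentiableAt_const _)]
  simp

lemma pd_comm {f : E m → F} {θ : E m} (hf : ContDiffAt ℝ 2 f θ) (i j : Fin m) :
    pd i (pd j f) θ = pd j (pd i f) θ := by
  rw [pd_pd_eq hf, pd_pd_eq hf]
  exact hf.isSymmSndFDerivAt (by simp) _ _

end PartialDerivatives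

/-! ### Independence of the parametrization -/

section Parametrization

variable {m : ℕ} {φ : E m → E (m + 1)} {θ : E m}

lemma firstForm_eq_gram (φ : E m → E (m + 1)) (θ : E m) :
    firstForm φ θ = gram ℝ (fun i => pd i φ θ) := rfl

lemma dualTangent_eq_frameDual (φ : E m → E (m + 1)) (i : Fin m) (θ : E m) :
    dualTangent φ i θ = frameDual (fun i => pd i φ θ) i := rfl

lemma weingarten_eq_frameWeingarten (φ : E m → E (m + 1)) (N : E (m + 1)) (θ : E m) :
    weingarten φ N θ
      = frameWeingarten (fun i => pd i φ θ) (fun i j => pd i (pd j φ) θ) N := rfl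

lemma unitNormal_eq_frameNormal (h : (firstForm φ θ).det ≠ 0) (w : E (m + 1)) :
    unitNormal φ w θ = frameNormal (fun i => pd i φ θ) w := by
  rw [unitNormal, starProjection_span_orthogonal h]; rfl

lemma meanCurv_eq_trace (φ : E m → E (m + 1)) (N : E (m + 1)) (θ : E m) :
    meanCurv φ N θ = LinearMap.trace ℝ (E (m + 1)) (weingarten φ N θ : E (m + 1) →L[ℝ] _) := by
  rw [weingarten, meanCurv, trace]
  simp only [ContinuousLinearMap.toLinearMap_sum, ContinuousLinearMap.toLinearMap_smul, map_sum,
    map_smul, trace_tensor, dualTangent_eq_frameDual, inner_frameDual_frameDual, diag_apply,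
    mul_apply, smul_eq_mul]
  rw [Finset.sum_comm]
  exact Finset.sum_congr rfl fun i _ => Finset.sum_congr rfl fun j _ => mul_comm _ _

lemma det_firstForm_ne_zero_iff :
    (firstForm φ θ).det ≠ 0 ↔ Function.Injective (fderiv ℝ φ θ) := by
  rw [firstForm_eq_gram, det_gram_ne_zero_iff_linearIndependent, Fintype.linearIndependent_iff,
    injective_iff_map_eq_zero]
  constructor
  · intro h a ha
    rw [fderiv_apply_eq_sum_pd] at ha
    ext i
    exact h a ha i
  · intro h g hg i
    have := h (WithLp.toLp 2 g) (by rw [fderiv_apply_eq_sum_pd]; exact hg)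
    simpa using congrArg (fun x : E m => x i) this

/-- The unit normal does not depend on the parametrization. -/
lemma unitNormal_comp {χ : E m → E m} (hφ : DifferentiableAt ℝ φ (χ θ))
    (hχ : DifferentiableAt ℝ χ θ) (hsurj : Function.Surjective (fderiv ℝ χ θ)) (w : E (m + 1)) :
    unitNormal (φ ∘ χ) w θ = unitNormal φ w (χ θ) := by
  have : Submodule.span ℝ (Set.range fun i => pd i (φ ∘ χ) θ)
      = Submodule.span ℝ (Set.range fun i => pd i φ (χ θ)) := by
    rw [span_range_pd, span_range_pd, fderiv_comp _ hφ hχ, ContinuousLinearMap.toLinearMap_comp,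
      LinearMap.range_comp_of_range_eq_top]
    exact LinearMap.range_eq_top.2 hsurj
  simp only [unitNormal, this]

lemma det_firstForm_comp_ne_zero {χ : E m → E m} (hφ : DifferentiableAt ℝ φ (χ θ))
    (hχ : DifferentiableAt ℝ χ θ) (hsurj : Function.Surjective (fderiv ℝ χ θ))
    (hdet : (firstForm φ (χ θ)).det ≠ 0) : (firstForm (φ ∘ χ) θ).det ≠ 0 := by
  rw [det_firstForm_ne_zero_iff] at hdet ⊢
  rw [fderiv_comp _ hφ hχ]
  exact hdet.comp (LinearMap.injective_iff_surjective (f := (fderiv ℝ χ θ : E m →ₗ[ℝ] E m)).2 hsurj)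

/-- The coordinate-free form of the second fundamental form, to be compared under a change of
parameters. -/
lemma inner_weingarten_fderiv (hφ : ContDiffAt ℝ 2 φ θ) (hdet : (firstForm φ θ).det ≠ 0)
    (N : E (m + 1)) (a b : E m) :
    inner ℝ (weingarten φ N θ (fderiv ℝ φ θ b)) (fderiv ℝ φ θ a)
      = inner ℝ (fderiv ℝ (fderiv ℝ φ) θ a b) N := by
  have hexp : ∀ c : E m, c = ∑ i, c i • EuclideanSpace.single i (1 : ℝ) := fun c => by
    ext j
    simp [Pi.single_apply]
  have h1 : fderiv ℝ (fderiv ℝ φ) θ a b = ∑ i, ∑ j, a i • b j • pd i (pd j φ) θ := by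
    conv_lhs => rw [hexp a, hexp b]
    simp only [map_sum, map_smul, _root_.sum_apply, _root_.smul_apply, pd_pd_eq hφ,
      Finset.smul_sum]
    rw [Finset.sum_comm]
    exact Finset.sum_congr rfl fun i _ => Finset.sum_congr rfl fun j _ => smul_comm _ _ _
  rw [h1, fderiv_apply_eq_sum_pd, fderiv_apply_eq_sum_pd, weingarten_eq_frameWeingarten]
  simp only [map_sum, map_smul, sum_inner, inner_sum, inner_smul_left, inner_smul_right,
    inner_frameWeingarten hdet, conj_trivial, Finset.mul_sum]

/-- The Weingarten tensor does not depend on the parametrization. -/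
lemma weingarten_comp {χ : E m → E m} (hφ : ContDiffAt ℝ 2 φ (χ θ)) (hχ : ContDiffAt ℝ 2 χ θ)
    (hsurj : Function.Surjective (fderiv ℝ χ θ)) (hdet : (firstForm φ (χ θ)).det ≠ 0)
    {N : E (m + 1)} (hN : ∀ i, inner ℝ (pd i φ (χ θ)) N = 0) :
    weingarten (φ ∘ χ) N θ = weingarten φ N (χ θ) := by
  -- Comparison by blocks requires a nonzero normal; for `N = 0` both tensors vanish.
  rcases eq_or_ne N 0 with rfl | hN0
  · have h0 : ∀ (ψ : E m → E (m + 1)) η, weingarten ψ 0 η = 0 := fun ψ η =>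
      Finset.sum_eq_zero fun i _ => Finset.sum_eq_zero fun j _ => by
        rw [show secondForm ψ 0 η i j = 0 from
          inner_zero_right (𝕜 := ℝ) (pd i (pd j ψ) η)]
        exact zero_smul ℝ (tensor (dualTangent ψ i η) (dualTangent ψ j η))
    rw [h0, h0]
  have hφ1 : DifferentiableAt ℝ φ (χ θ) := hφ.differentiableAt (by norm_num)
  have hχ1 : DifferentiableAt ℝ χ θ := hχ.differentiableAt (by norm_num)
  have hφ2 : DifferentiableAt ℝ (fderiv ℝ φ) (χ θ) :=
    (hφ.fderiv_right (m := 1) (by norm_num)).differentiableAt (by norm_num)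
  have hχ2 : DifferentiableAt ℝ (fderiv ℝ χ) θ :=
    (hχ.fderiv_right (m := 1) (by norm_num)).differentiableAt (by norm_num)
  have hN' : ∀ a, inner ℝ (fderiv ℝ φ (χ θ) a) N = 0 := fun a => by
    simp [fderiv_apply_eq_sum_pd, sum_inner, inner_smul_left, hN]
  have hN'' : ∀ i, inner ℝ (pd i (φ ∘ χ) θ) N = 0 := fun i => by
    rw [pd, fderiv_comp _ hφ1 hχ1]
    exact hN' _
  have hdet' := det_firstForm_comp_ne_zero hφ1 hχ1 hsurj hdet
  refine operator_ext_frame (τ := fun i => pd i (φ ∘ χ) θ) hdet' hN0 hN'' (fun i j => ?_) ?_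
    fun x => ?_
  · have hpd : ∀ i, pd i (φ ∘ χ) θ = fderiv ℝ φ (χ θ) (pd i χ θ) := fun i => by
      rw [pd, fderiv_comp _ hφ1 hχ1]; rfl
    have hev : pd j (φ ∘ χ) =ᶠ[𝓝 θ] fun η => fderiv ℝ φ (χ η) (pd j χ η) := by
      filter_upwards [hχ.eventually (by simp), hχ.continuousAt.eventually (hφ.eventually (by simp))]
        with η h1 h2
      rw [pd, fderiv_comp _ (h2.differentiableAt (by norm_num))
        (h1.differentiableAt (by norm_num))]
      rfl
    -- The term with second derivatives of `χ` is tangential, so pairing with `N` removes it.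
    have h2 : pd i (pd j (φ ∘ χ)) θ = fderiv ℝ (fderiv ℝ φ) (χ θ) (pd i χ θ) (pd j χ θ)
        + fderiv ℝ φ (χ θ) (pd i (pd j χ) θ) := by
      rw [pd_congr hev, pd, fderiv_clm_apply (hφ2.fun_comp' θ hχ1)
        ((contDiffAt_pd hχ (r := 1) (by norm_num) j).differentiableAt (by norm_num)),
        fderiv_fun_comp θ hφ2 hχ1]
      simp only [_root_.add_apply, ContinuousLinearMap.comp_apply, ContinuousLinearMap.flip_apply]
      exact add_comm _ _
    rw [weingarten_eq_frameWeingarten, inner_frameWeingarten hdet', h2, hpd, hpd,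
      inner_weingarten_fderiv hφ hdet, inner_add_left, hN', add_zero]
  · rw [weingarten_eq_frameWeingarten, weingarten_eq_frameWeingarten,
      frameWeingarten_apply_eq_zero _ hN, frameWeingarten_apply_eq_zero _ hN'']
  · rw [weingarten_eq_frameWeingarten, weingarten_eq_frameWeingarten,
      inner_frameWeingarten_eq_zero _ hN, inner_frameWeingarten_eq_zero _ hN'']

end Parametrization

/-! ### The Laplace–Beltrami operator as the trace of the second gradient -/

section Laplace

variable {m : ℕ} {φ : E m → E (m + 1)} {θ : E m} {u : E m → ℝ}

lemma contDiffAt_dualTangent (hφ : ContDiffAt ℝ 2 φ θ) (hdet : (firstForm φ θ).det ≠ 0)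
    (i : Fin m) : ContDiffAt ℝ 1 (dualTangent φ i) θ :=
  contDiffAt_frameDual (τ := fun η i => pd i φ η)
    (fun i => contDiffAt_pd hφ (by norm_num) i) hdet i

lemma contDiffAt_grad (hφ : ContDiffAt ℝ 2 φ θ) (hu : ContDiffAt ℝ 2 u θ)
    (hdet : (firstForm φ θ).det ≠ 0) : ContDiffAt ℝ 1 (grad φ u) θ :=
  ContDiffAt.sum fun i _ => (contDiffAt_pd hu (by norm_num) i).smul
    (contDiffAt_dualTangent hφ hdet i)

lemma eventually_det_firstForm_ne_zero (hφ : ContDiffAt ℝ 2 φ θ)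
    (hdet : (firstForm φ θ).det ≠ 0) : ∀ᶠ η in 𝓝 θ, (firstForm φ η).det ≠ 0 :=
  (contDiffAt_det (r := 1) (contDiffAt_gram (τ := fun η i => pd i φ η)
    fun i => contDiffAt_pd hφ (by norm_num) i)).continuousAt.eventually_ne hdet

/-- The pairing of a tangential field with `∂ᵢ τⁱ + ½ g^{kl} ∂ᵢ g_{kl} τⁱ` vanishes. -/
lemma inner_pd_sum_pd_dualTangent (hφ : ContDiffAt ℝ 2 φ θ) (hdet : (firstForm φ θ).det ≠ 0)
    (k : Fin m) :
    inner ℝ (pd k φ θ) (∑ i, (pd i (dualTangent φ i) θ +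
      ((firstForm φ θ).det⁻¹ * pd i (fun η => (firstForm φ η).det) θ / 2) • dualTangent φ i θ))
      = 0 := by
  have hpd : ∀ i, DifferentiableAt ℝ (pd i φ) θ := fun i =>
    (contDiffAt_pd hφ (r := 1) (by norm_num) i).differentiableAt (by norm_num)
  have hdual : ∀ i, DifferentiableAt ℝ (dualTangent φ i) θ := fun i =>
    (contDiffAt_dualTangent hφ hdet i).differentiableAt (by norm_num)
  have h1 : ∀ i, inner ℝ (pd k φ θ) (dualTangent φ i θ) = if i = k then (1 : ℝ) else 0 :=
    fun i => by rw [real_inner_comm]; exact inner_frameDual hdet i k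
  -- Differentiate the duality relation `(τₖ | τⁱ) = δ`, then exchange the second derivatives of
  -- `φ`.
  have h2 : ∀ i, inner ℝ (pd k φ θ) (pd i (dualTangent φ i) θ)
      = - inner ℝ (pd k (pd i φ) θ) (dualTangent φ i θ) := fun i => by
    have hc : (fun η => inner ℝ (pd k φ η) (dualTangent φ i η))
        =ᶠ[𝓝 θ] fun _ => if i = k then (1 : ℝ) else 0 := by
      filter_upwards [eventually_det_firstForm_ne_zero hφ hdet] with η hη
      rw [real_inner_comm]; exact inner_frameDual hη i k
    have h := pd_congr hc i
    rw [pd_inner (hpd k) (hdual i)] at h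
    have h0 : pd i (fun _ : E m => if i = k then (1 : ℝ) else 0) θ = 0 := by
      simp [pd]
    rw [h0] at h
    rw [pd_comm hφ k i]
    linarith
  -- Jacobi's formula; the two halves of `∂ₖ gᵢⱼ` contribute equally by symmetry of `g^{ij}`.
  have h3 : pd k (fun η => (firstForm φ η).det) θ
      = (firstForm φ θ).det * (2 * ∑ i, inner ℝ (pd k (pd i φ) θ) (dualTangent φ i θ)) := by
    have hG : ∀ i j, DifferentiableAt ℝ (fun η => firstForm φ η i j) θ := fun i j =>
      (hpd i).inner ℝ (hpd j)
    have hG' : ∀ i j, fderiv ℝ (fun η => firstForm φ η i j) θ (EuclideanSpace.single k 1)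
        = inner ℝ (pd i φ θ) (pd k (pd j φ) θ) + inner ℝ (pd k (pd i φ) θ) (pd j φ θ) :=
      fun i j => pd_inner (hpd i) (hpd j) k
    rw [pd, fderiv_det hG hdet]
    congr 1
    simp only [hG', mul_add, Finset.sum_add_distrib, two_mul]
    have hdual' : ∀ i, inner ℝ (pd k (pd i φ) θ) (dualTangent φ i θ)
        = ∑ j, (firstForm φ θ)⁻¹ i j * inner ℝ (pd j φ θ) (pd k (pd i φ) θ) := fun i => by
      rw [dualTangent, inner_sum]
      exact Finset.sum_congr rfl fun j _ => by rw [inner_smul_right, real_inner_comm]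
    simp only [hdual']
    congr 1
    rw [Finset.sum_comm]
    refine Finset.sum_congr rfl fun i _ => Finset.sum_congr rfl fun j _ => ?_
    rw [real_inner_comm, firstForm_eq_gram, gram_inv_symm]
  simp only [inner_sum, inner_add_right, inner_smul_right, h1, h2, Finset.sum_add_distrib,
    mul_ite, mul_one, mul_zero, Finset.sum_ite_eq', Finset.mem_univ, if_true,
    Finset.sum_neg_distrib, h3]
  rw [inv_mul_cancel_left₀ hdet]
  ring

/-- By the product rule the two sides differ by the pairing of `∇u` with `∂ᵢ τⁱ + ½ g⁻¹ (∂ᵢ g) τⁱ`,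
a normal vector. -/
lemma laplaceBeltrami_eq_trace_grad2 (hφ : ContDiffAt ℝ 2 φ θ) (hu : ContDiffAt ℝ 2 u θ)
    (hdet : (firstForm φ θ).det ≠ 0) :
    laplaceBeltrami φ u θ
      = LinearMap.trace ℝ (E (m + 1)) (grad2 φ u θ : E (m + 1) →L[ℝ] E (m + 1)) := by
  have hpos : 0 < (firstForm φ θ).det :=
    ((posSemidef_gram ℝ fun i => pd i φ θ).det_nonneg).lt_of_ne' hdet
  have hgrad : DifferentiableAt ℝ (grad φ u) θ :=
    (contDiffAt_grad hφ hu hdet).differentiableAt (by norm_num)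
  have hdual : ∀ i, DifferentiableAt ℝ (dualTangent φ i) θ := fun i =>
    (contDiffAt_dualTangent hφ hdet i).differentiableAt (by norm_num)
  have hd : DifferentiableAt ℝ (fun η => (firstForm φ η).det) θ :=
    (contDiffAt_det (r := 1) (contDiffAt_gram (τ := fun η i => pd i φ η)
      fun i => contDiffAt_pd hφ (by norm_num) i)).differentiableAt (by norm_num)
  have hsqrt : ∀ i, pd i (fun η => √(firstForm φ η).det) θ
      = pd i (fun η => (firstForm φ η).det) θ / (2 * √(firstForm φ θ).det) := fun i => by
    rw [pd, fderiv_sqrt hd hdet, pd]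
    simp only [_root_.smul_apply, smul_eq_mul]
    ring
  have hz : inner ℝ (grad φ u θ) (∑ i, (pd i (dualTangent φ i) θ +
      ((firstForm φ θ).det⁻¹ * pd i (fun η => (firstForm φ η).det) θ / 2) • dualTangent φ i θ))
      = 0 := by
    have h := inner_frameDual_eq_zero (inner_pd_sum_pd_dualTangent hφ hdet)
    rw [grad, sum_inner]
    refine Finset.sum_eq_zero fun i _ => ?_
    rw [inner_smul_left, dualTangent_eq_frameDual, h i, mul_zero]
  rw [grad2, gradVec]
  simp only [ContinuousLinearMap.toLinearMap_sum, map_sum, trace_tensor]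
  rw [laplaceBeltrami, surfDiv, ← sub_eq_zero, ← hz, Finset.mul_sum, ← Finset.sum_sub_distrib,
    inner_sum]
  refine Finset.sum_congr rfl fun i _ => ?_
  rw [pd_mul (hd.sqrt hdet) (hgrad.inner ℝ (hdual i)), hsqrt, pd_inner hgrad (hdual i),
    inner_add_right, inner_smul_right]
  have hs : √(firstForm φ θ).det * √(firstForm φ θ).det = (firstForm φ θ).det :=
    Real.mul_self_sqrt hpos.le
  have hs0 : √(firstForm φ θ).det ≠ 0 := (Real.sqrt_pos.2 hpos).ne'
  rw [show (firstForm φ θ).det⁻¹ = (√(firstForm φ θ).det * √(firstForm φ θ).det)⁻¹ by rw [hs]]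
  field_simp
  ring

end Laplace

/-! ### The variation of the Weingarten tensor at a point -/

section FrameVariation

variable {m : ℕ}

/-- First and second derivatives of a parametrization, together with a transversal vector. -/
abbrev FrameData (m : ℕ) := (Fin m → E (m + 1)) × (Fin m → Fin m → E (m + 1)) × E (m + 1)

/-- The Weingarten tensor of a parametrization with the given derivatives, with respect to the
unit normal on the side of the given vector. -/
noncomputable def frameShape (d : FrameData m) : E (m + 1) →L[ℝ] E (m + 1) :=
  frameWeingarten d.1 d.2.1 (frameNormal d.1 d.2.2)

lemma contDiffAt_frameNormal_data {d : FrameData m} (h₀ : (gram ℝ d.1).det ≠ 0)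
    (h₁ : frameNormalPart d.1 d.2.2 ≠ 0) :
    ContDiffAt ℝ 1 (fun d : FrameData m => frameNormal d.1 d.2.2) d :=
  contDiffAt_frameNormal (τ := fun d : FrameData m => d.1) (w := fun d => d.2.2)
    (fun i => ((contDiff_apply ℝ (E (m + 1)) i).comp contDiff_fst).contDiffAt)
    (contDiff_snd.comp contDiff_snd).contDiffAt h₀ h₁

lemma contDiffAt_frameShape {d : FrameData m} (h₀ : (gram ℝ d.1).det ≠ 0)
    (h₁ : frameNormalPart d.1 d.2.2 ≠ 0) : ContDiffAt ℝ 1 (frameShape (m := m)) d :=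
  contDiffAt_frameWeingarten (τ := fun d : FrameData m => d.1) (s := fun d => d.2.1)
    (N := fun d => frameNormal d.1 d.2.2)
    (fun i => ((contDiff_apply ℝ (E (m + 1)) i).comp contDiff_fst).contDiffAt)
    (fun i j => ((contDiff_apply_apply ℝ (E (m + 1)) i j).comp
      (contDiff_fst.comp contDiff_snd)).contDiffAt)
    (contDiffAt_frameNormal_data h₀ h₁) h₀

lemma norm_frameNormal {n : ℕ} {τ : Fin m → E n} {w : E n} (h : frameNormalPart τ w ≠ 0) :
    ‖frameNormal τ w‖ = 1 := by
  rw [frameNormal, norm_smul, norm_inv, norm_norm, inv_mul_cancel₀ (norm_ne_zero_iff.2 h)]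

lemma eventually_det_gram_ne_zero {d : FrameData m} (h₀ : (gram ℝ d.1).det ≠ 0) :
    ∀ᶠ d' : FrameData m in 𝓝 d, (gram ℝ d'.1).det ≠ 0 :=
  (contDiffAt_det (r := 1) (contDiffAt_gram (τ := fun d : FrameData m => d.1)
    fun i => ((contDiff_apply ℝ (E (m + 1)) i).comp contDiff_fst).contDiffAt)).continuousAt
    |>.eventually_ne h₀

lemma eventually_frameNormalPart_ne_zero {d : FrameData m} (h₀ : (gram ℝ d.1).det ≠ 0)
    (h₁ : frameNormalPart d.1 d.2.2 ≠ 0) :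
    ∀ᶠ d' : FrameData m in 𝓝 d, frameNormalPart d'.1 d'.2.2 ≠ 0 :=
  (contDiffAt_frameNormalPart (r := 1) (τ := fun d : FrameData m => d.1) (w := fun d => d.2.2)
    (fun i => ((contDiff_apply ℝ (E (m + 1)) i).comp contDiff_fst).contDiffAt)
    (contDiff_snd.comp contDiff_snd).contDiffAt h₀).continuousAt.eventually_ne h₁

lemma hasDerivAt_line {F : Type*} [NormedAddCommGroup F] [NormedSpace ℝ F] (a b : F) :
    HasDerivAt (fun ε : ℝ => a + ε • b) b 0 := by
  simpa using ((hasDerivAt_id (0 : ℝ)).smul_const b).const_add a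

lemma eq_zero_of_hasDerivAt_of_eventually_eq {F : Type*} [NormedAddCommGroup F] [NormedSpace ℝ F]
    {f : ℝ → F} {f' c : F} (hf : HasDerivAt f f' 0) (h : ∀ᶠ ε in 𝓝 (0 : ℝ), f ε = c) : f' = 0 :=
  hf.unique ((hasDerivAt_const (0 : ℝ) c).congr_of_eventuallyEq h)

/-- The equations that determine the derivative of the Weingarten tensor along a line of frames. -/
lemma frameShape_variation {τ σ : Fin m → E (m + 1)} {s t : Fin m → Fin m → E (m + 1)}
    {N : E (m + 1)} (h₀ : (gram ℝ τ).det ≠ 0) (hN : ‖N‖ = 1) (hn : ∀ i, inner ℝ (τ i) N = 0)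
    {W' : E (m + 1) →L[ℝ] E (m + 1)}
    (hW : fderiv ℝ frameShape ((τ, s, N) : FrameData m) (σ, t, 0) = W') :
    ∃ n' : E (m + 1),
      (∀ i, inner ℝ (τ i) n' = - inner ℝ (σ i) N) ∧ inner ℝ N n' = 0 ∧
      (∀ i j, inner ℝ (W' (τ j)) (τ i) = inner ℝ (t i j) N + inner ℝ (s i j) n'
        - inner ℝ (frameWeingarten τ s N (σ j)) (τ i)
        - inner ℝ (frameWeingarten τ s N (τ j)) (σ i)) ∧
      W' N = - frameWeingarten τ s N n' ∧
      ∀ x, inner ℝ (W' x) N = - inner ℝ (frameWeingarten τ s N x) n' := by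
  set d : FrameData m := (τ, s, N) with hd
  set e : FrameData m := (σ, t, 0) with he
  -- At `ε = 0` the computed normal is the given `N`.
  have hN0 : frameNormal τ N = N :=
    frameNormal_of_unit h₀ hN hn (by rw [real_inner_self_eq_norm_sq, hN]; norm_num)
  have hp : frameNormalPart τ N ≠ 0 := by
    rw [frameNormalPart_of_unit h₀ hN hn, real_inner_self_eq_norm_sq, hN]
    have : N ≠ 0 := by rintro rfl; simp at hN
    simpa using this
  have hline : HasDerivAt (fun ε : ℝ => d + ε • e) e 0 := hasDerivAt_line d e
  have hcont : Filter.Tendsto (fun ε : ℝ => d + ε • e) (𝓝 0) (𝓝 d) := by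
    simpa using hline.continuousAt.tendsto
  have hdet := hcont.eventually (eventually_det_gram_ne_zero (d := d) h₀)
  have hpart := hcont.eventually (eventually_frameNormalPart_ne_zero (d := d) h₀ hp)
  have e0 : d + (0 : ℝ) • e = d := by simp
  have hn' : HasDerivAt (fun ε : ℝ => frameNormal (τ + ε • σ) N)
      (fderiv ℝ (fun d : FrameData m => frameNormal d.1 d.2.2) d e) 0 := by
    have h := ((contDiffAt_frameNormal_data (d := d) h₀ hp).differentiableAt
      (by norm_num)).hasFDerivAt
    rw [← e0] at h
    have h2 := h.comp_hasDerivAt (0 : ℝ) hline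
    rw [e0] at h2
    refine h2.congr_of_eventuallyEq (Filter.Eventually.of_forall fun ε => ?_)
    simp [hd, he]
  have hW' : HasDerivAt (fun ε : ℝ => frameShape (d + ε • e)) W' 0 := by
    rw [← hW]
    have h := ((contDiffAt_frameShape (d := d) h₀ hp).differentiableAt (by norm_num)).hasFDerivAt
    rw [← e0] at h
    have h2 := h.comp_hasDerivAt (0 : ℝ) hline
    rw [e0] at h2
    exact h2
  have hS : ∀ ε : ℝ, frameShape (d + ε • e)
      = frameWeingarten (τ + ε • σ) (s + ε • t) (frameNormal (τ + ε • σ) N) := fun ε => by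
    simp [frameShape, hd, he]
  have hS0 : frameShape (d + (0 : ℝ) • e) = frameWeingarten τ s N := by
    rw [hS]; simp [hN0]
  have hτl : ∀ i, HasDerivAt (fun ε : ℝ => (τ + ε • σ) i) (σ i) 0 := fun i =>
    hasDerivAt_line (τ i) (σ i)
  have hsl : ∀ i j, HasDerivAt (fun ε : ℝ => (s + ε • t) i j) (t i j) 0 := fun i j =>
    hasDerivAt_line (s i j) (t i j)
  -- The witness is the derivative of the unit normal. Each claim is the derivative at `0` of an
  -- identity valid for small `ε`: orthogonality to the frame, unit length, and the three relations
  -- that characterize the Weingarten tensor.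
  refine ⟨fderiv ℝ (fun d : FrameData m => frameNormal d.1 d.2.2) d e, fun i => ?_, ?_,
    fun i j => ?_, ?_, fun x => ?_⟩
  · have h := eq_zero_of_hasDerivAt_of_eventually_eq (c := 0) ((hτl i).inner ℝ hn') (by
      filter_upwards [hdet] with ε hε
      exact inner_frameNormal (by simpa [hd, he] using hε) N i)
    simp only [zero_smul, add_zero, hN0] at h
    linarith
  · have h := eq_zero_of_hasDerivAt_of_eventually_eq (c := 1) (hn'.inner ℝ hn') (by
      filter_upwards [hpart] with ε hε
      rw [real_inner_self_eq_norm_sq, norm_frameNormal (by simpa [hd, he] using hε)]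
      norm_num)
    simp only [zero_smul, add_zero, hN0] at h
    rw [real_inner_comm N] at h
    linarith
  · have h := eq_zero_of_hasDerivAt_of_eventually_eq (c := 0)
      ((((hW'.clm_apply (hτl j)).inner ℝ (hτl i))).sub ((hsl i j).inner ℝ hn')) (by
        filter_upwards [hdet] with ε hε
        rw [Pi.sub_apply, hS, inner_frameWeingarten (by simpa [hd, he] using hε), sub_self])
    simp only [hS0] at h
    simp only [zero_smul, add_zero, hN0, inner_add_left] at h
    linarith
  · have h := eq_zero_of_hasDerivAt_of_eventually_eq (c := 0) (hW'.clm_apply hn') (by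
      filter_upwards [hdet] with ε hε
      rw [hS]
      exact frameWeingarten_apply_eq_zero _
        (inner_frameNormal (by simpa [hd, he] using hε) N))
    simp only [hS0] at h
    simp only [zero_smul, add_zero, hN0] at h
    exact eq_neg_of_add_eq_zero_left h
  · have h := eq_zero_of_hasDerivAt_of_eventually_eq (c := 0)
      ((hW'.clm_apply (hasDerivAt_const (0 : ℝ) x)).inner ℝ hn') (by
      filter_upwards [hdet] with ε hε
      rw [hS]
      exact inner_frameWeingarten_eq_zero _
        (inner_frameNormal (by simpa [hd, he] using hε) N) x)
    simp only [hS0] at h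
    simp only [zero_smul, add_zero, hN0, map_zero] at h
    linarith

end FrameVariation

/-! ### Normal variations of a parametrized hypersurface -/

section NormalVariation

variable {m : ℕ} {φ v : E m → E (m + 1)} {u : E m → ℝ} {θ : E m}

lemma inner_grad (hdet : (firstForm φ θ).det ≠ 0) (i : Fin m) :
    inner ℝ (grad φ u θ) (pd i φ θ) = pd i u θ := by
  have : ∀ j, inner ℝ (dualTangent φ j θ) (pd i φ θ) = if j = i then (1 : ℝ) else 0 :=
    fun j => inner_frameDual hdet j i
  simp [grad, sum_inner, inner_smul_left, this]

lemma inner_grad_eq_zero {N : E (m + 1)} (hN : ∀ i, inner ℝ (pd i φ θ) N = 0) :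
    inner ℝ (grad φ u θ) N = 0 := by
  have : ∀ j, inner ℝ (dualTangent φ j θ) N = 0 := inner_frameDual_eq_zero hN
  simp [grad, sum_inner, inner_smul_left, this]

lemma pd_eq_zero_of_eventually_eq {f : E m → ℝ} {c : ℝ} (h : ∀ᶠ η in 𝓝 θ, f η = c) (i : Fin m) :
    pd i f θ = 0 := by
  have h' : f =ᶠ[𝓝 θ] fun _ => c := h
  rw [pd_congr h']
  simp [pd]

/-- The derivative of a unit vector field is orthogonal to the field. -/
lemma inner_pd_unit (hv : DifferentiableAt ℝ v θ) (hunit : ∀ᶠ η in 𝓝 θ, ‖v η‖ = 1) (i : Fin m) :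
    inner ℝ (pd i v θ) (v θ) = 0 := by
  have h := pd_eq_zero_of_eventually_eq (f := fun η => inner ℝ (v η) (v η)) (c := 1)
    (hunit.mono fun η hη => by rw [real_inner_self_eq_norm_sq, hη]; norm_num) i
  rw [pd_inner hv hv, real_inner_comm] at h
  linarith

/-- The Weingarten equations `∂ᵢ ν = - L τᵢ`. -/
lemma pd_normal (hφ : ContDiffAt ℝ 2 φ θ) (hv : ContDiffAt ℝ 2 v θ)
    (hdet : (firstForm φ θ).det ≠ 0) (hunit : ∀ᶠ η in 𝓝 θ, ‖v η‖ = 1)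
    (hnor : ∀ᶠ η in 𝓝 θ, ∀ i, inner ℝ (pd i φ η) (v η) = 0) (i : Fin m) :
    pd i v θ = - weingarten φ (v θ) θ (pd i φ θ) := by
  have hv1 : DifferentiableAt ℝ v θ := hv.differentiableAt (by norm_num)
  have hn := hnor.self_of_nhds
  have h0 : v θ ≠ 0 := fun h => by have := hunit.self_of_nhds; simp [h] at this
  refine eq_of_inner_frame_eq (τ := fun i => pd i φ θ) hdet h0 hn (fun j => ?_) ?_
  · have h := pd_eq_zero_of_eventually_eq (hnor.mono fun η hη => hη j) i
    rw [pd_inner ((contDiffAt_pd hφ (r := 1) (by norm_num) j).differentiableAt (by norm_num)) hv1]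
      at h
    have h2 := inner_frameWeingarten hdet (fun i j => pd i (pd j φ) θ) (v θ) j i
    rw [inner_neg_left, weingarten_eq_frameWeingarten, h2, pd_comm hφ j i, real_inner_comm]
    linarith
  · rw [inner_pd_unit hv1 hunit, inner_neg_left, weingarten_eq_frameWeingarten,
      inner_frameWeingarten_eq_zero _ hn, neg_zero]

/-- The derivative of the Weingarten tensor under the normal variation `φ + ε u ν`. -/
theorem fderiv_frameShape_normal_variation (hφ : ContDiffAt ℝ 2 φ θ) (hv : ContDiffAt ℝ 2 v θ)
    (hu : ContDiffAt ℝ 2 u θ)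
    (hdet : (firstForm φ θ).det ≠ 0) (hunit : ∀ᶠ η in 𝓝 θ, ‖v η‖ = 1)
    (hnor : ∀ᶠ η in 𝓝 θ, ∀ i, inner ℝ (pd i φ η) (v η) = 0) :
    fderiv ℝ frameShape
        ((fun i => pd i φ θ, fun i j => pd i (pd j φ) θ, v θ) : FrameData m)
        (fun i => pd i (fun η => u η • v η) θ, fun i j => pd i (pd j fun η => u η • v η) θ, 0)
      = tensor (v θ) (weingarten φ (v θ) θ (grad φ u θ))
        + u θ • (weingarten φ (v θ) θ ∘L weingarten φ (v θ) θ) + grad2 φ u θ := by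
  have hn := hnor.self_of_nhds
  have hv1 : DifferentiableAt ℝ v θ := hv.differentiableAt (by norm_num)
  have hu1 : DifferentiableAt ℝ u θ := hu.differentiableAt (by norm_num)
  have hpv : ∀ i, DifferentiableAt ℝ (pd i v) θ := fun i =>
    (contDiffAt_pd hv (r := 1) (by norm_num) i).differentiableAt (by norm_num)
  have hpu : ∀ i, DifferentiableAt ℝ (pd i u) θ := fun i =>
    (contDiffAt_pd hu (r := 1) (by norm_num) i).differentiableAt (by norm_num)
  have hpφ : ∀ i, DifferentiableAt ℝ (pd i φ) θ := fun i =>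
    (contDiffAt_pd hφ (r := 1) (by norm_num) i).differentiableAt (by norm_num)
  have hgrad : DifferentiableAt ℝ (grad φ u) θ :=
    (contDiffAt_grad hφ hu hdet).differentiableAt (by norm_num)
  have hN1 : ‖v θ‖ = 1 := hunit.self_of_nhds
  have h0 : v θ ≠ 0 := fun h => by simp [h] at hN1
  have hself : inner ℝ (v θ) (v θ) = (1 : ℝ) := by rw [real_inner_self_eq_norm_sq, hN1]; norm_num
  have hnu : ∀ i, inner ℝ (pd i v θ) (v θ) = 0 := inner_pd_unit hv1 hunit
  have hdv := pd_normal hφ hv hdet hunit hnor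
  obtain ⟨n', hn1, hn2, hW1, hW2, hW3⟩ := frameShape_variation
    (σ := fun i => pd i (fun η => u η • v η) θ)
    (s := fun i j => pd i (pd j φ) θ) (t := fun i j => pd i (pd j fun η => u η • v η) θ)
    hdet hN1 hn rfl
  set W' := fderiv ℝ frameShape
        ((fun i => pd i φ θ, fun i j => pd i (pd j φ) θ, v θ) : FrameData m)
        (fun i => pd i (fun η => u η • v η) θ, fun i j => pd i (pd j fun η => u η • v η) θ, 0)
  rw [← weingarten_eq_frameWeingarten] at hW1 hW2 hW3
  set L := weingarten φ (v θ) θ with hL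
  have hsymm : ∀ x y, inner ℝ (L x) y = inner ℝ x (L y) :=
    inner_frameWeingarten_comm (fun i j => pd_comm hφ i j) (v θ)
  have hLN : L (v θ) = 0 := frameWeingarten_apply_eq_zero _ hn
  have hLN' : ∀ x, inner ℝ (L x) (v θ) = 0 := inner_frameWeingarten_eq_zero _ hn
  have hσ : ∀ i, pd i (fun η => u η • v η) θ = u θ • pd i v θ + pd i u θ • v θ := fun i =>
    pd_smul hu1 hv1 i
  -- The normal tilts against the gradient: only the part `(∂ᵢ u) ν` of `∂ᵢ (u ν)` has a normal
  -- component.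
  have hn' : n' = - grad φ u θ := by
    refine eq_of_inner_frame_eq (τ := fun i => pd i φ θ) hdet h0 hn (fun i => ?_) ?_
    · rw [real_inner_comm, hn1, hσ, inner_neg_left, inner_grad hdet, inner_add_left,
        inner_smul_left, inner_smul_left, hnu, hself]
      simp
    · rw [real_inner_comm, hn2, inner_neg_left, inner_grad_eq_zero hn, neg_zero]
  -- Differentiate `(∂ⱼ ν | ν) = 0` and insert the Weingarten equations.
  have hvv : ∀ i j, inner ℝ (pd i (pd j v) θ) (v θ) = - inner ℝ (L (L (pd j φ θ))) (pd i φ θ) :=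
    fun i j => by
      have hev : ∀ᶠ η in 𝓝 θ, inner ℝ (pd j v η) (v η) = 0 := by
        filter_upwards [hunit.eventually_nhds, hv.eventually (by simp)] with η h1 h2
        exact inner_pd_unit (h2.differentiableAt (by norm_num)) h1 j
      have h := pd_eq_zero_of_eventually_eq hev i
      rw [pd_inner (hpv j) hv1, hdv i, hdv j, inner_neg_neg, ← hsymm] at h
      linarith
  have ht : ∀ i j, inner ℝ (pd i (pd j fun η => u η • v η) θ) (v θ)
      = pd i (pd j u) θ - u θ * inner ℝ (L (L (pd j φ θ))) (pd i φ θ) := fun i j => by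
    have hev : pd j (fun η => u η • v η) =ᶠ[𝓝 θ] fun η => u η • pd j v η + pd j u η • v η := by
      filter_upwards [hu.eventually (by simp), hv.eventually (by simp)] with η h1 h2
      exact pd_smul (h1.differentiableAt (by norm_num)) (h2.differentiableAt (by norm_num)) j
    rw [pd_congr hev, pd_add (hu1.fun_smul (hpv j)) ((hpu j).fun_smul hv1), pd_smul hu1 (hpv j),
      pd_smul (hpu j) hv1]
    simp only [inner_add_left, inner_smul_left, hnu, hself, hvv, conj_trivial]
    ring
  have hg2 : ∀ x, grad2 φ u θ x
      = ∑ k, inner ℝ (pd k (grad φ u) θ) x • dualTangent φ k θ := fun x => by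
    simp [grad2, gradVec, tensor]
  refine operator_ext_frame (τ := fun i => pd i φ θ) hdet h0 hn (fun i j => ?_) ?_ fun x => ?_
  -- Tangential block: `∂ᵢ ∂ⱼ (u ν)` contributes `-u L²`, and each of the two terms with a varied
  -- tangent vector contributes `+u L²`, leaving `u L²`. The rest is `∇²u`, found by differentiating
  -- `(∇u | τⱼ) = ∂ⱼ u`.
  · have hgτ : inner ℝ (grad2 φ u θ (pd j φ θ)) (pd i φ θ)
        = pd i (pd j u) θ - inner ℝ (pd i (pd j φ) θ) (grad φ u θ) := by
      have hd : ∀ k, inner ℝ (dualTangent φ k θ) (pd i φ θ) = if k = i then (1 : ℝ) else 0 :=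
        fun k => inner_frameDual hdet k i
      have hev : (fun η => inner ℝ (grad φ u η) (pd j φ η)) =ᶠ[𝓝 θ] pd j u := by
        filter_upwards [eventually_det_firstForm_ne_zero hφ hdet] with η hη
        exact inner_grad hη j
      have h := pd_congr hev i
      rw [pd_inner hgrad (hpφ j)] at h
      rw [hg2]
      simp only [sum_inner, inner_smul_left, hd, conj_trivial, mul_ite, mul_one, mul_zero,
        Finset.sum_ite_eq', Finset.mem_univ, if_true]
      rw [← h, real_inner_comm (grad φ u θ)]
      ring
    have hn'' : inner ℝ (v θ) (pd i φ θ) = 0 := by rw [real_inner_comm, hn]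
    rw [hW1, ht, hσ, hσ, hdv, hdv, hn']
    simp only [map_add, map_smul, map_neg, hLN, _root_.add_apply, _root_.smul_apply,
      ContinuousLinearMap.comp_apply, tensor_apply, inner_add_left, inner_add_right,
      inner_smul_left, inner_smul_right, inner_neg_left, inner_neg_right, hLN', hn'', hgτ,
      conj_trivial, inner_zero_left, ← hsymm]
    ring
  -- Differentiating `(∇u | ν) = 0` gives the normal component of `∂ₖ ∇u`, hence `∇²u ν = L ∇u`.
  · have hk : ∀ k, inner ℝ (pd k (grad φ u) θ) (v θ) = inner ℝ (L (grad φ u θ)) (pd k φ θ) :=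
      fun k => by
        have h := pd_eq_zero_of_eventually_eq (f := fun η => inner ℝ (grad φ u η) (v η))
          (hnor.mono fun η hη => inner_grad_eq_zero hη) k
        rw [pd_inner hgrad hv1, hdv, inner_neg_right, ← hsymm] at h
        linarith
    have hgν : grad2 φ u θ (v θ) = L (grad φ u θ) := by
      have hd : ∀ k i, inner ℝ (dualTangent φ k θ) (pd i φ θ) = if k = i then (1 : ℝ) else 0 :=
        inner_frameDual hdet
      have hd' : ∀ k, inner ℝ (dualTangent φ k θ) (v θ) = 0 := inner_frameDual_eq_zero hn
      rw [hg2]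
      refine eq_of_inner_frame_eq (τ := fun i => pd i φ θ) hdet h0 hn (fun i => ?_) ?_
      · simp [sum_inner, inner_smul_left, hd, hk]
      · simp [sum_inner, inner_smul_left, hd', hLN']
    rw [hW2, hn']
    simp [tensor_apply, hLN, hLN', hgν]
  -- Normal component of the values: `∇²u` and `L²` have tangential range, so only `ν ⊗ L ∇u`
  -- contributes.
  · have hd : ∀ k, inner ℝ (dualTangent φ k θ) (v θ) = 0 := inner_frameDual_eq_zero hn
    rw [hW3, hn', inner_neg_right, neg_neg, hsymm]
    simp only [_root_.add_apply, _root_.smul_apply, ContinuousLinearMap.comp_apply, tensor_apply,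
      inner_add_left, inner_smul_left, hLN', hself, hg2, sum_inner, hd, conj_trivial, mul_zero,
      Finset.sum_const_zero, add_zero, mul_one]
    rw [real_inner_comm]

end NormalVariation

/-! ### Uniform convergence from joint limits -/

section Uniform

/-- Joint limits force the limit function to be continuous on `K`; convergence is then locally
uniform, hence uniform by compactness. -/
lemma tendstoUniformlyOn_of_forall_tendsto_prod {ι α β : Type*} [TopologicalSpace α]
    [PseudoMetricSpace β] {F : ι → α → β} {f : α → β} {l : Filter ι} [l.NeBot] {K : Set α}
    (hK : IsCompact K)
    (h : ∀ x ∈ K, Filter.Tendsto (fun y : ι × α => F y.1 y.2) (l ×ˢ 𝓝[K] x) (𝓝 (f x))) :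
    TendstoUniformlyOn F f l K := by
  have hpt : ∀ x ∈ K, Filter.Tendsto (fun i => F i x) l (𝓝 (f x)) := fun x hx =>
    (h x hx).comp (Filter.tendsto_id.prodMk (tendsto_const_nhdsWithin hx))
  have hcont : ContinuousOn f K := by
    intro x hx
    rw [ContinuousWithinAt, Metric.tendsto_nhds]
    intro ε hε
    have h1 : ∀ᶠ y in (l ×ˢ 𝓝[K] x), dist (F y.1 y.2) (f x) < ε / 2 :=
      Metric.tendsto_nhds.1 (h x hx) _ (half_pos hε)
    filter_upwards [(Filter.eventually_swap_iff.1 h1).curry, self_mem_nhdsWithin] with x' hx' hxK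
    have := le_of_tendsto ((hpt x' hxK).dist tendsto_const_nhds) (hx'.mono fun i hi => hi.le)
    linarith
  rw [← tendstoLocallyUniformlyOn_iff_tendstoUniformlyOn_of_compact hK,
    tendstoLocallyUniformlyOn_iff_forall_tendsto]
  intro x hx
  exact (((hcont x hx).tendsto.comp Filter.tendsto_snd).prodMk_nhds (h x hx)).mono_right
    (nhds_le_uniformity (f x))

/-- Strictness allows the base point `d y` to move with `y`: the remainder is `o(c y • e y)`, and
`e` is bounded near the limit. -/
lemma tendsto_slope_of_hasStrictFDerivAt {V F Y : Type*} [NormedAddCommGroup V] [NormedSpace ℝ V]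
    [NormedAddCommGroup F] [NormedSpace ℝ F] {f : V → F} {f' : V →L[ℝ] F} {a b : V}
    (hf : HasStrictFDerivAt f f' a) {l : Filter Y} {c : Y → ℝ} {d e : Y → V}
    (hc : Filter.Tendsto c l (𝓝[≠] 0)) (hd : Filter.Tendsto d l (𝓝 a))
    (he : Filter.Tendsto e l (𝓝 b)) :
    Filter.Tendsto (fun y => (c y)⁻¹ • (f (d y + c y • e y) - f (d y))) l (𝓝 (f' b)) := by
  have hc0 : Filter.Tendsto c l (𝓝 0) := hc.mono_right nhdsWithin_le_nhds
  have hcne : ∀ᶠ y in l, c y ≠ 0 := hc.eventually self_mem_nhdsWithin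
  have h1 : Filter.Tendsto (fun y => (d y + c y • e y, d y)) l (𝓝 (a, a)) := by
    have := hd.add (hc0.smul he)
    rw [zero_smul, add_zero] at this
    exact this.prodMk_nhds hd
  have h2 := hf.isLittleO.comp_tendsto h1
  have h3 : (fun y => (d y + c y • e y) - d y) =O[l] c := by
    have : (fun y => c y • e y) =O[l] fun y => c y • (1 : ℝ) :=
      (Asymptotics.isBigO_refl c l).smul (he.isBigO_one ℝ)
    simpa using this
  have h4 := (h2.trans_isBigO h3).tendsto_inv_smul_nhds_zero
  have h5 := h4.add ((f'.continuous.tendsto b).comp he)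
  rw [zero_add] at h5
  refine h5.congr' ?_
  filter_upwards [hcne] with y hy
  simp [smul_sub, hy]

end Uniform

/-! ### Charts of a closed hypersurface -/

section Inclusion

variable {m : ℕ}

lemma contDiff_incl {r : WithTop ℕ∞} : ContDiff ℝ r (incl (m := m)) := by
  rw [contDiff_euclidean]
  intro i
  refine Fin.lastCases ?_ (fun j => ?_) i
  · simpa [incl] using contDiff_const
  · have : ContDiff ℝ r fun θ : E m => θ j := contDiff_euclidean.1 contDiff_id j
    simpa [incl] using this

/-- The projection of `ℝᵐ⁺¹` onto its first `m` coordinates. -/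
def initProj (x : E (m + 1)) : E m := WithLp.toLp 2 fun i => x i.castSucc

lemma contDiff_initProj {r : WithTop ℕ∞} : ContDiff ℝ r (initProj (m := m)) := by
  rw [contDiff_euclidean]
  intro i
  exact contDiff_euclidean.1 contDiff_id i.castSucc

lemma initProj_incl (θ : E m) : initProj (incl θ) = θ := by
  ext i; simp [initProj, incl]

lemma incl_initProj {x : E (m + 1)} (hx : x (Fin.last m) = 0) : incl (initProj x) = x := by
  ext i
  refine Fin.lastCases ?_ (fun j => ?_) i
  · simp [incl, hx]
  · simp [incl, initProj]

lemma incl_last (θ : E m) : incl θ (Fin.last m) = 0 := by simp [incl]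

lemma incl_zero : incl (0 : E m) = 0 := by
  ext i
  refine Fin.lastCases ?_ (fun j => ?_) i <;> simp [incl]

end Inclusion

/-! ### Local coordinates, transition maps and regularity of the normal field -/

namespace ClosedHypersurface

variable {m : ℕ} {k : WithTop ℕ∞} (S : ClosedHypersurface m k) {p q : E (m + 1)} {θ : E m}

/-- The local coordinates at `p`, inverse to `param p` on the hypersurface. -/
def coord (p x : E (m + 1)) : E m := initProj (S.chart p x)

lemma isOpen_paramDomain (p : E (m + 1)) : IsOpen (S.paramDomain p) :=
  (S.chart p).open_target.preimage (contDiff_incl (r := 0)).continuous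

lemma mem_source (hp : p ∈ S.carrier) : p ∈ (S.chart p).source := by
  obtain ⟨r, hr, h⟩ := S.source_eq p hp
  rw [h]; exact Metric.mem_ball_self hr

lemma zero_mem_paramDomain (hp : p ∈ S.carrier) : (0 : E m) ∈ S.paramDomain p := by
  have := (S.chart p).map_source (S.mem_source hp)
  rw [S.map_center p hp] at this
  simpa [paramDomain, incl_zero] using this

lemma param_zero (hp : p ∈ S.carrier) : S.param p 0 = p := by
  rw [param, incl_zero, ← S.map_center p hp, (S.chart p).left_inv (S.mem_source hp)]

lemma contDiffAt_param (hp : p ∈ S.carrier) (hθ : θ ∈ S.paramDomain p) :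
    ContDiffAt ℝ k (S.param p) θ :=
  ((S.contDiffOn_symm p hp).contDiffAt ((S.chart p).open_target.mem_nhds hθ)).comp θ
    contDiff_incl.contDiffAt

lemma param_mem_source (hθ : θ ∈ S.paramDomain p) : S.param p θ ∈ (S.chart p).source :=
  (S.chart p).map_target hθ

lemma chart_param (hθ : θ ∈ S.paramDomain p) : S.chart p (S.param p θ) = incl θ :=
  (S.chart p).right_inv hθ

lemma param_mem_carrier (hp : p ∈ S.carrier) (hθ : θ ∈ S.paramDomain p) :
    S.param p θ ∈ S.carrier := by
  rw [S.flat p hp _ (S.param_mem_source hθ), S.chart_param hθ, incl_last]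

lemma coord_param (hθ : θ ∈ S.paramDomain p) : S.coord p (S.param p θ) = θ := by
  rw [coord, S.chart_param hθ, initProj_incl]

lemma incl_coord (hp : p ∈ S.carrier) (hq : q ∈ S.carrier) (hqs : q ∈ (S.chart p).source) :
    incl (S.coord p q) = S.chart p q :=
  incl_initProj ((S.flat p hp q hqs).1 hq)

lemma coord_mem_paramDomain (hp : p ∈ S.carrier) (hq : q ∈ S.carrier)
    (hqs : q ∈ (S.chart p).source) : S.coord p q ∈ S.paramDomain p := by
  rw [paramDomain, Set.mem_preimage, S.incl_coord hp hq hqs]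
  exact (S.chart p).map_source hqs

lemma param_coord (hp : p ∈ S.carrier) (hq : q ∈ S.carrier) (hqs : q ∈ (S.chart p).source) :
    S.param p (S.coord p q) = q := by
  rw [param, S.incl_coord hp hq hqs, (S.chart p).left_inv hqs]

lemma contDiffAt_coord (hp : p ∈ S.carrier) (hqs : q ∈ (S.chart p).source) :
    ContDiffAt ℝ k (S.coord p) q :=
  contDiff_initProj.contDiffAt.comp q
    ((S.contDiffOn p hp).contDiffAt ((S.chart p).open_source.mem_nhds hqs))

lemma injective_fderiv_param (hk : k ≠ 0) (hp : p ∈ S.carrier) (hθ : θ ∈ S.paramDomain p) :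
    Function.Injective (fderiv ℝ (S.param p) θ) := by
  have h1 : S.coord p ∘ S.param p =ᶠ[𝓝 θ] id := by
    filter_upwards [(S.isOpen_paramDomain p).mem_nhds hθ] with η hη
    exact S.coord_param hη
  have h2 := h1.fderiv_eq (𝕜 := ℝ)
  rw [fderiv_comp _ ((S.contDiffAt_coord hp (S.param_mem_source hθ)).differentiableAt hk)
    ((S.contDiffAt_param hp hθ).differentiableAt hk), fderiv_id] at h2
  exact Function.LeftInverse.injective (g := fderiv ℝ (S.coord p) (S.param p θ)) fun a =>
    congrArg (fun A : E m →L[ℝ] E m => A a) h2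

lemma det_firstForm_param_ne_zero (hk : k ≠ 0) (hp : p ∈ S.carrier)
    (hθ : θ ∈ S.paramDomain p) : (firstForm (S.param p) θ).det ≠ 0 :=
  det_firstForm_ne_zero_iff.2 (S.injective_fderiv_param hk hp hθ)

/-- The change of parametrization between the charts at two points. -/
def transition (p q : E (m + 1)) (η : E m) : E m := S.coord p (S.param q η)

lemma transition_zero (hq : q ∈ S.carrier) : S.transition p q 0 = S.coord p q := by
  rw [transition, S.param_zero hq]

lemma contDiffAt_transition (hp : p ∈ S.carrier) (hq : q ∈ S.carrier)
    (hqs : q ∈ (S.chart p).source) : ContDiffAt ℝ k (S.transition p q) 0 :=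
  ContDiffAt.comp (g := S.coord p) 0
    (S.contDiffAt_coord hp (by rwa [S.param_zero hq]))
    (S.contDiffAt_param hq (S.zero_mem_paramDomain hq))

lemma param_eventuallyEq (hp : p ∈ S.carrier) (hq : q ∈ S.carrier)
    (hqs : q ∈ (S.chart p).source) : S.param q =ᶠ[𝓝 0] S.param p ∘ S.transition p q := by
  have h0 := S.zero_mem_paramDomain hq
  have hcont : ContinuousAt (S.param q) 0 := (S.contDiffAt_param hq h0).continuousAt
  have hs : (S.chart p).source ∈ 𝓝 (S.param q 0) := by
    rw [S.param_zero hq]; exact (S.chart p).open_source.mem_nhds hqs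
  filter_upwards [(S.isOpen_paramDomain q).mem_nhds h0, hcont hs] with η hη hη'
  exact (S.param_coord hp (S.param_mem_carrier hq hη) hη').symm

lemma fderiv_param_eq_comp (hk : k ≠ 0) (hp : p ∈ S.carrier) (hq : q ∈ S.carrier)
    (hqs : q ∈ (S.chart p).source) :
    fderiv ℝ (S.param q) 0
      = fderiv ℝ (S.param p) (S.coord p q) ∘L fderiv ℝ (S.transition p q) 0 := by
  rw [(S.param_eventuallyEq hp hq hqs).fderiv_eq, fderiv_comp, S.transition_zero hq]
  · rw [S.transition_zero hq]
    exact (S.contDiffAt_param hp (S.coord_mem_paramDomain hp hq hqs)).differentiableAt hk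
  · exact (S.contDiffAt_transition hp hq hqs).differentiableAt hk

/-- The injective derivative of `param q` factors through that of the transition map, which is thus
injective between spaces of equal dimension. -/
lemma surjective_fderiv_transition (hk : k ≠ 0) (hp : p ∈ S.carrier) (hq : q ∈ S.carrier)
    (hqs : q ∈ (S.chart p).source) :
    Function.Surjective (fderiv ℝ (S.transition p q) 0) := by
  have h := S.injective_fderiv_param hk hq (S.zero_mem_paramDomain hq)
  rw [S.fderiv_param_eq_comp hk hp hq hqs] at h
  exact LinearMap.injective_iff_surjective
    (f := (fderiv ℝ (S.transition p q) 0 : E m →ₗ[ℝ] E m)).1 (Function.Injective.of_comp h)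

lemma tendsto_coord (hp : p ∈ S.carrier) :
    Filter.Tendsto (S.coord p) (𝓝[S.carrier] p) (𝓝 0) := by
  have h := (S.contDiffAt_coord hp (S.mem_source hp)).continuousAt.tendsto
  have h0 : S.coord p p = 0 := by
    rw [← S.transition_zero hp, transition, S.coord_param (S.zero_mem_paramDomain hp)]
  rw [h0] at h
  exact h.mono_left nhdsWithin_le_nhds

variable {S} {ν : E (m + 1) → E (m + 1)}

/-- Orthogonality is postulated only at the centre of each chart. The tangent vectors at another
point of the chart at `p` are carried to the chart centred at that point. -/
lemma IsUnitNormalField.inner_pd_param (hν : S.IsUnitNormalField ν) (hk : k ≠ 0)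
    (hp : p ∈ S.carrier) (hθ : θ ∈ S.paramDomain p) (i : Fin m) :
    inner ℝ (pd i (S.param p) θ) (ν (S.param p θ)) = 0 := by
  have hq := S.param_mem_carrier hp hθ
  have hqs := S.param_mem_source hθ
  obtain ⟨a, ha⟩ := S.surjective_fderiv_transition hk hp hq hqs (EuclideanSpace.single i 1)
  have h : pd i (S.param p) θ = fderiv ℝ (S.param (S.param p θ)) 0 a := by
    rw [S.fderiv_param_eq_comp hk hp hq hqs, S.coord_param hθ, ContinuousLinearMap.comp_apply, ha]
    rfl
  rw [h, fderiv_apply_eq_sum_pd, sum_inner]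
  refine Finset.sum_eq_zero fun j _ => ?_
  rw [inner_smul_left, hν.normal _ hq, mul_zero]

/-- A continuous unit normal field is of class `C²` in the parameters. -/
lemma IsUnitNormalField.contDiffAt (hν : S.IsUnitNormalField ν) (hk : 3 ≤ k)
    (hp : p ∈ S.carrier) : ContDiffAt ℝ 2 (fun θ => ν (S.param p θ)) 0 := by
  have hk0 : k ≠ 0 := by rintro rfl; simp at hk
  have h0 := S.zero_mem_paramDomain hp
  have hD := (S.isOpen_paramDomain p).mem_nhds h0
  have hφ : ContDiffAt ℝ 3 (S.param p) 0 := (S.contDiffAt_param hp h0).of_le hk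
  have hdet := S.det_firstForm_param_ne_zero hk0 hp h0
  have hself : inner ℝ (ν p) (ν p) = (1 : ℝ) := by
    rw [real_inner_self_eq_norm_sq, hν.norm_eq_one p hp]; norm_num
  have hpart : frameNormalPart (fun i => pd i (S.param p) 0) (ν p) ≠ 0 := by
    rw [frameNormalPart_of_unit hdet (hν.norm_eq_one p hp) (hν.normal p hp), hself, one_smul]
    intro h
    have := hν.norm_eq_one p hp
    simp [h] at this
  -- With the fixed vector `ν p` the normal is a smooth function of the `C²` tangent frame.
  -- Continuity of `ν` keeps it on the side of `ν p`, so it coincides with this normal near `0`.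
  have hsm : ContDiffAt ℝ 2 (fun θ => frameNormal (fun i => pd i (S.param p) θ) (ν p)) 0 :=
    contDiffAt_frameNormal (τ := fun θ i => pd i (S.param p) θ)
      (fun i => contDiffAt_pd hφ (by norm_num) i) contDiffAt_const hdet hpart
  have hcont : Filter.Tendsto (fun θ => inner ℝ (ν (S.param p θ)) (ν p)) (𝓝 0) (𝓝 (1 : ℝ)) := by
    have h1 : Filter.Tendsto (S.param p) (𝓝 0) (𝓝[S.carrier] p) := by
      refine tendsto_nhdsWithin_iff.2 ⟨?_, ?_⟩
      · have := hφ.continuousAt.tendsto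
        rwa [S.param_zero hp] at this
      · filter_upwards [hD] with θ hθ
        exact S.param_mem_carrier hp hθ
    rw [← hself]
    exact ((hν.continuousOn p hp).tendsto.comp h1).inner tendsto_const_nhds
  refine hsm.congr_of_eventuallyEq ?_
  filter_upwards [hD, hcont.eventually_const_lt one_pos] with θ hθ hpos
  exact (frameNormal_of_unit (S.det_firstForm_param_ne_zero hk0 hp hθ)
    (hν.norm_eq_one _ (S.param_mem_carrier hp hθ)) (hν.inner_pd_param hk0 hp hθ) hpos).symm

end ClosedHypersurface

/-! ### Locality, and the data of a parametrization up to second order -/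

section Congruence

variable {m : ℕ} {φ ψ : E m → E (m + 1)} {θ : E m}

lemma weingarten_congr (h : φ =ᶠ[𝓝 θ] ψ) (N : E (m + 1)) :
    weingarten φ N θ = weingarten ψ N θ := by
  rw [weingarten_eq_frameWeingarten, weingarten_eq_frameWeingarten]
  simp only [pd_congr h, pd_congr (pd_eventuallyEq h _)]

lemma unitNormal_congr (h : φ =ᶠ[𝓝 θ] ψ) (w : E (m + 1)) :
    unitNormal φ w θ = unitNormal ψ w θ := by
  simp only [unitNormal, pd_congr h]

end Congruence

/-- The derivatives of `φ`, with the transversal vector `w`. -/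
noncomputable def jetData {m : ℕ} (φ : E m → E (m + 1)) (w : E m → E (m + 1)) (θ : E m) :
    FrameData m :=
  (fun i => pd i φ θ, fun i j => pd i (pd j φ) θ, w θ)

lemma continuousAt_jetData {m : ℕ} {φ w : E m → E (m + 1)} {θ : E m} (hφ : ContDiffAt ℝ 2 φ θ)
    (hw : ContinuousAt w θ) : ContinuousAt (jetData φ w) θ := by
  have h1 : ∀ i, ContDiffAt ℝ 1 (pd i φ) θ := fun i => contDiffAt_pd hφ (by norm_num) i
  have h2 : ∀ i j, ContDiffAt ℝ 0 (pd i (pd j φ)) θ := fun i j =>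
    contDiffAt_pd (h1 j) (by norm_num) i
  exact (continuousAt_pi.2 fun i => (h1 i).continuousAt).prodMk
    ((continuousAt_pi.2 fun i => continuousAt_pi.2 fun j => (h2 i j).continuousAt).prodMk hw)

/-- The data are affine in `ε`; the transversal vector is kept fixed, whence the `0` in the
direction. -/
lemma jetData_add_smul {m : ℕ} {φ z w : E m → E (m + 1)} {θ : E m} (hφ : ContDiffAt ℝ 2 φ θ)
    (hz : ContDiffAt ℝ 2 z θ) (ε : ℝ) :
    jetData (fun η => φ η + ε • z η) w θ = jetData φ w θ + ε • jetData z 0 θ := by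
  have hev : ∀ j, pd j (fun η => φ η + ε • z η) =ᶠ[𝓝 θ] fun η => pd j φ η + ε • pd j z η := by
    intro j
    filter_upwards [hφ.eventually (by simp), hz.eventually (by simp)] with η h1 h2
    have h2' : DifferentiableAt ℝ z η := h2.differentiableAt (by norm_num)
    rw [pd_add (h1.differentiableAt (by norm_num)) (h2'.fun_const_smul ε), pd_const_smul ε h2']
  have hd : ∀ {f : E m → E (m + 1)}, ContDiffAt ℝ 2 f θ → ∀ j, DifferentiableAt ℝ (pd j f) θ :=
    fun hf j => (contDiffAt_pd hf (r := 1) (by norm_num) j).differentiableAt (by norm_num)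
  refine Prod.ext (funext fun i => (hev i).self_of_nhds) (Prod.ext ?_ ?_)
  · funext i j
    change pd i (pd j _) θ = pd i (pd j φ) θ + ε • pd i (pd j z) θ
    rw [pd_congr (hev j), pd_add (hd hφ j) ((hd hz j).fun_const_smul ε),
      pd_const_smul ε (hd hz j)]
  · simp [jetData]

/-! ### First variation on the closed hypersurface -/

namespace ClosedHypersurface

variable {m : ℕ} {k : WithTop ℕ∞} {S : ClosedHypersurface m k} {p : E (m + 1)}
  {ν : E (m + 1) → E (m + 1)} {h : E (m + 1) → ℝ}

/-- The Weingarten tensor of a normal graph, computed at all nearby points in one chart. -/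
lemma graphWeingarten_eventually_eq (hk : 3 ≤ k) (hν : S.IsUnitNormalField ν)
    (hh : S.IsOfClass 2 h) (hp : p ∈ S.carrier) :
    ∀ᶠ y : ℝ × E (m + 1) in 𝓝 0 ×ˢ 𝓝[S.carrier] p,
      S.graphWeingarten ν (y.1 • h) y.2
        = frameShape (jetData (S.param p) (ν ∘ S.param p) (S.coord p y.2)
          + y.1 • jetData (fun θ => h (S.param p θ) • ν (S.param p θ)) 0 (S.coord p y.2)) := by
  have hk0 : k ≠ 0 := by rintro rfl; simp at hk
  have hk2 : (2 : WithTop ℕ∞) ≤ k := le_trans (by norm_num) hk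
  have h0 := S.zero_mem_paramDomain hp
  have hv : ContDiffAt ℝ 2 (fun θ => ν (S.param p θ)) 0 := hν.contDiffAt hk hp
  have hu : ContDiffAt ℝ 2 (fun θ => h (S.param p θ)) 0 :=
    (hh p hp).contDiffAt ((S.isOpen_paramDomain p).mem_nhds h0)
  have hφ : ContDiffAt ℝ 2 (S.param p) 0 := (S.contDiffAt_param hp h0).of_le hk2
  have hz : ContDiffAt ℝ 2 (fun θ => h (S.param p θ) • ν (S.param p θ)) 0 := hu.smul hv
  have hcoord : Filter.Tendsto (fun y : ℝ × E (m + 1) => S.coord p y.2)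
      (𝓝 0 ×ˢ 𝓝[S.carrier] p) (𝓝 0) :=
    (S.tendsto_coord hp).comp Filter.tendsto_snd
  have hjet : Filter.Tendsto (fun y : ℝ × E (m + 1) =>
      jetData (S.param p) (ν ∘ S.param p) (S.coord p y.2)
        + y.1 • jetData (fun θ => h (S.param p θ) • ν (S.param p θ)) 0 (S.coord p y.2))
      (𝓝 0 ×ˢ 𝓝[S.carrier] p) (𝓝 (jetData (S.param p) (ν ∘ S.param p) 0)) := by
    have h1 := (continuousAt_jetData hφ hv.continuousAt).tendsto.comp hcoord
    have h2 := (continuousAt_jetData (w := 0) hz continuousAt_const).tendsto.comp hcoord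
    have h3 := h1.add ((Filter.tendsto_fst (f := 𝓝 (0 : ℝ)) (g := 𝓝[S.carrier] p)).smul h2)
    rw [zero_smul, add_zero] at h3
    exact h3
  have hdet : (gram ℝ (jetData (S.param p) (ν ∘ S.param p) 0).1).det ≠ 0 :=
    S.det_firstForm_param_ne_zero hk0 hp h0
  filter_upwards [hcoord.eventually (hφ.eventually (by simp)),
    hcoord.eventually (hz.eventually (by simp)),
    hjet.eventually (eventually_det_gram_ne_zero hdet),
    Filter.tendsto_snd.eventually (self_mem_nhdsWithin (a := p) (s := S.carrier)),
    Filter.tendsto_snd.eventually (mem_nhdsWithin_of_mem_nhds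
      ((S.chart p).open_source.mem_nhds (S.mem_source hp)))] with y hφ' hz' hdet' hq hqs
  obtain ⟨ε, q⟩ := y
  dsimp only at *
  set θ := S.coord p q with hθ
  set Φ : E m → E (m + 1) := fun η => S.param p η + ε • (h (S.param p η) • ν (S.param p η)) with hΦ
  have hΦ2 : ContDiffAt ℝ 2 Φ θ := hφ'.add (contDiffAt_const.fun_smul hz')
  have htr : S.transition p q 0 = θ := S.transition_zero hq
  -- The graph parametrized from the chart at `q` is a reparametrization of the graph over the chart
  -- at `p`.
  have hev : S.graphParam ν (ε • h) q =ᶠ[𝓝 0] Φ ∘ S.transition p q := by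
    filter_upwards [S.param_eventuallyEq hp hq hqs] with η hη
    simp only [graphParam, graphMap, hη, hΦ, Function.comp_apply, Pi.smul_apply, smul_assoc]
  have hχ : ContDiffAt ℝ 2 (S.transition p q) 0 :=
    (S.contDiffAt_transition hp hq hqs).of_le hk2
  have hsurj := S.surjective_fderiv_transition hk0 hp hq hqs
  rw [← jetData_add_smul hφ' hz' ε] at hdet' ⊢
  have hΦdet : (firstForm Φ θ).det ≠ 0 := hdet'
  have hνq : ν q = ν (S.param p θ) := by rw [S.param_coord hp hq hqs]
  have hN : S.graphNormal ν (ε • h) q = frameNormal (fun i => pd i Φ θ) (ν (S.param p θ)) := by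
    rw [graphNormal, unitNormal_congr hev, unitNormal_comp
      (by rw [htr]; exact hΦ2.differentiableAt (by norm_num))
      (hχ.differentiableAt (by norm_num)) hsurj, htr, unitNormal_eq_frameNormal hΦdet, hνq]
  rw [graphWeingarten, weingarten_congr hev, weingarten_comp (by rwa [htr]) hχ hsurj
    (by rwa [htr]), htr, hN]
  · rfl
  · rw [htr, hN]
    exact inner_frameNormal hΦdet _

/-- The first variation of the Weingarten tensor at a point, with the difference quotients
converging jointly in the parameter and the point. -/
theorem tendsto_graphWeingarten_slope (hk : 3 ≤ k) (hν : S.IsUnitNormalField ν)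
    (hh : S.IsOfClass 2 h) (hp : p ∈ S.carrier) :
    Filter.Tendsto (fun y : ℝ × E (m + 1) =>
        y.1⁻¹ • (S.graphWeingarten ν (0 + y.1 • h) y.2 - S.graphWeingarten ν 0 y.2))
      (𝓝[≠] 0 ×ˢ 𝓝[S.carrier] p)
      (𝓝 (tensor (ν p) (S.weingartenAt ν p (S.gradAt h p))
        + h p • (S.weingartenAt ν p ∘L S.weingartenAt ν p) + S.grad2At h p)) := by
  have hk0 : k ≠ 0 := by rintro rfl; simp at hk
  have hk2 : (2 : WithTop ℕ∞) ≤ k := le_trans (by norm_num) hk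
  have h0 := S.zero_mem_paramDomain hp
  have hD := (S.isOpen_paramDomain p).mem_nhds h0
  have hv : ContDiffAt ℝ 2 (fun θ => ν (S.param p θ)) 0 := hν.contDiffAt hk hp
  have hu : ContDiffAt ℝ 2 (fun θ => h (S.param p θ)) 0 := (hh p hp).contDiffAt hD
  have hφ : ContDiffAt ℝ 2 (S.param p) 0 := (S.contDiffAt_param hp h0).of_le hk2
  have hz : ContDiffAt ℝ 2 (fun θ => h (S.param p θ) • ν (S.param p θ)) 0 := hu.smul hv
  have hdet := S.det_firstForm_param_ne_zero hk0 hp h0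
  have hunit : ∀ᶠ η in 𝓝 0, ‖ν (S.param p η)‖ = 1 := by
    filter_upwards [hD] with η hη
    exact hν.norm_eq_one _ (S.param_mem_carrier hp hη)
  have hnor : ∀ᶠ η in 𝓝 0, ∀ i, inner ℝ (pd i (S.param p) η) (ν (S.param p η)) = 0 := by
    filter_upwards [hD] with η hη
    exact hν.inner_pd_param hk0 hp hη
  have hcoord : Filter.Tendsto (fun y : ℝ × E (m + 1) => S.coord p y.2)
      (𝓝[≠] 0 ×ˢ 𝓝[S.carrier] p) (𝓝 0) :=
    (S.tendsto_coord hp).comp Filter.tendsto_snd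
  have hpart : frameNormalPart (jetData (S.param p) (ν ∘ S.param p) 0).1
      (jetData (S.param p) (ν ∘ S.param p) 0).2.2 ≠ 0 := by
    have h1 := hunit.self_of_nhds
    change frameNormalPart (fun i => pd i (S.param p) 0) (ν (S.param p 0)) ≠ 0
    rw [frameNormalPart_of_unit hdet h1 hnor.self_of_nhds, real_inner_self_eq_norm_sq, h1]
    intro h2
    rw [one_pow, one_smul] at h2
    simp [h2] at h1
  have hstrict := (contDiffAt_frameShape (d := jetData (S.param p) (ν ∘ S.param p) 0) hdet
    hpart).hasStrictFDerivAt (by norm_num)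
  have hslope := tendsto_slope_of_hasStrictFDerivAt hstrict
    (Filter.tendsto_fst (f := 𝓝[≠] (0 : ℝ)) (g := 𝓝[S.carrier] p))
    ((continuousAt_jetData hφ hv.continuousAt).tendsto.comp hcoord)
    ((continuousAt_jetData (w := 0) hz continuousAt_const).tendsto.comp hcoord)
  have hval : fderiv ℝ frameShape (jetData (S.param p) (ν ∘ S.param p) 0)
        (jetData (fun θ => h (S.param p θ) • ν (S.param p θ)) 0 0)
      = tensor (ν p) (S.weingartenAt ν p (S.gradAt h p))
        + h p • (S.weingartenAt ν p ∘L S.weingartenAt ν p) + S.grad2At h p := by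
    refine (fderiv_frameShape_normal_variation hφ hv hu hdet hunit hnor).trans ?_
    rw [S.param_zero hp]
    rfl
  have hlim := hslope.congr' (f₂ := fun y : ℝ × E (m + 1) =>
      y.1⁻¹ • (S.graphWeingarten ν (0 + y.1 • h) y.2 - S.graphWeingarten ν 0 y.2)) (by
    have hev := graphWeingarten_eventually_eq hk hν hh hp
    have hle : 𝓝[≠] (0 : ℝ) ×ˢ 𝓝[S.carrier] p ≤ 𝓝 0 ×ˢ 𝓝[S.carrier] p :=
      Filter.prod_mono nhdsWithin_le_nhds le_rfl
    -- The subtracted term is the same one-chart formula at `ε = 0`.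
    have hzero : Filter.Tendsto (fun y : ℝ × E (m + 1) => ((0 : ℝ), y.2))
        (𝓝[≠] (0 : ℝ) ×ˢ 𝓝[S.carrier] p) (𝓝 0 ×ˢ 𝓝[S.carrier] p) :=
      tendsto_const_nhds.prodMk Filter.tendsto_snd
    filter_upwards [hev.filter_mono hle, hzero.eventually hev] with y h1 h2
    simp only [zero_smul, add_zero] at h2
    rw [zero_add, h1, h2]
    rfl)
  rw [hval] at hlim
  exact hlim

end ClosedHypersurface

end NormalGraph

open NormalGraph in
theorem mainTheorem1 {m : ℕ} {k : WithTop ℕ∞} (hk : 3 ≤ k) (S : ClosedHypersurface m k)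
    (ν : E (m + 1) → E (m + 1)) (hν : S.IsUnitNormalField ν)
    (h : E (m + 1) → ℝ) (hh : S.IsOfClass 2 h) :
    S.HasVariation (S.graphMeanCurv ν) 0 h
      (fun p => LinearMap.trace ℝ (E (m + 1))
          (S.weingartenAt ν p ∘L S.weingartenAt ν p : E (m + 1) →L[ℝ] E (m + 1)) * h p
        + S.laplaceAt h p) ∧
    S.HasVariation (S.graphWeingarten ν) 0 h
      (fun p => tensor (ν p) (S.weingartenAt ν p (S.gradAt h p))
        + h p • (S.weingartenAt ν p ∘L S.weingartenAt ν p)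
        + S.grad2At h p) := by
  refine ⟨tendstoUniformlyOn_of_forall_tendsto_prod S.isCompact fun p hp => ?_,
    tendstoUniformlyOn_of_forall_tendsto_prod S.isCompact fun p hp =>
      ClosedHypersurface.tendsto_graphWeingarten_slope hk hν hh hp⟩
  have hk0 : k ≠ 0 := by rintro rfl; simp at hk
  have h0 := S.zero_mem_paramDomain hp
  let T : (E (m + 1) →L[ℝ] E (m + 1)) →ₗ[ℝ] ℝ :=
    LinearMap.trace ℝ (E (m + 1)) ∘ₗ ContinuousLinearMap.coeLM ℝ
  have hT : Continuous T := T.continuous_of_finiteDimensional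
  have hmean : ∀ ρ q, S.graphMeanCurv ν ρ q = T (S.graphWeingarten ν ρ q) := fun ρ q =>
    meanCurv_eq_trace _ _ _
  have hlap : S.laplaceAt h p = T (S.grad2At h p) :=
    laplaceBeltrami_eq_trace_grad2
      ((S.contDiffAt_param hp h0).of_le (le_trans (by norm_num) hk))
      ((hh p hp).contDiffAt ((S.isOpen_paramDomain p).mem_nhds h0))
      (S.det_firstForm_param_ne_zero hk0 hp h0)
  -- Its trace is `(L ∇h | ν)`, and `L` has tangential range.
  have hten : T (tensor (ν p) (S.weingartenAt ν p (S.gradAt h p))) = 0 := by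
    refine (trace_tensor _ _).trans ?_
    exact inner_frameWeingarten_eq_zero _ (hν.normal p hp) _
  have hlim := (hT.tendsto _).comp
    (ClosedHypersurface.tendsto_graphWeingarten_slope hk hν hh hp)
  rw [map_add, map_add, hten, map_smul, zero_add, ← hlap, smul_eq_mul, mul_comm (h p)] at hlim
  refine hlim.congr fun y => ?_
  simp only [Function.comp_apply, map_smul, map_sub, hmean]
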